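/- **Theorem (coverage with multiple precoder groups).** Let $N, D, N_r, N_t \ge 1$ be integers and let $P_T, \sigma^2, T > 0$, $\rho = P_T/\sigma^2$; if $T<1$, assume $N \ge 2$. Let $\mathbf p_{n,d} \in \mathbb C^{N_t}$ ($1\le n\le N$, $1\le d\le D$) be random vectors that are almost surely orthonormal (so $ND \le N_t$); the group $\mathbf p_{1,d},\dots,\mathbf p_{N,d}$ is used in time slot $d$. Let the channel, constant over the $D$ slots and independent of the precoding vectors, be a matrix $\mathbf H \in \mathbb C^{N_r\times N_t}$ with i.i.d. $\mathcal{CN}(0,1)$ entries and rows $\mathbf h_1^T,\dots,\mathbf h_{N_r}^T$ (for a single-antenna receiver $N_r=1$ and $\mathbf h=\mathbf h_1$). For a channel vector $\mathbf h$ put $$SINR_{n,d}(\mathbf h)=\frac{|\mathbf h^T\mathbf p_{n,d}|^2\,\frac{P_T}{N}}{\sigma^2+\sum_{i\ne n}|\mathbf h^T\mathbf p_{i,d}|^2\,\frac{P_T}{N}}=\frac{|\mathbf h^T\mathbf p_{n,d}|^2}{\frac N\rho+\sum_{i\ne n}|\mathbf h^T\mathbf p_{i,d}|^2}.$$ Then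 the downlink coverage probabilities with a single-antenna receiver and with antenna selection over $N_r$ receive antennas are $$\Pr\Big\{\max_{n,d} SINR_{n,d}(\mathbf h)>T\Big\}=1-(1-P_{DL})^{D},\qquad \Pr\Big\{\max_{n,d,r} SINR_{n,d}(\mathbf h_r)>T\Big\}=1-(1-P_{DL})^{N_rD},$$ where $P_{DL}=\frac{N}{(T+1)^{N-1}}e^{-TN/\rho}$ if $T\ge1$ and, with $m=\lceil 1/T\rceil$, $P_{DL}=P_1+\sum_{k=2}^{m-1}P_k+P_m^{\ast}$ if $T<1$. Here $$P_1=\frac{N}{(N-2)!}\left(e^{-\frac{TN}{\rho}}C_1+C_2\right),$$ $$P_k=\xi_k\!\left(e^{-\frac{TN}{\rho}}\frac{T^l}{l!}D_1-\frac{D_2}{(k-1)^l\,l!}\right)+\xi_k\!\left(\frac{E_1}{k^l\,l!}-\frac{E_2}{(k-1)^l\,l!}\right),\qquad P_m^{\ast}=\xi_m\!\left(e^{-\frac{TN}{\rho}}\frac{T^l}{l!}F_1-\frac{F_2}{(m-1)^l\,l!}\right),$$ where, for an expression $(\cdot)$ depending on the indices $i,l$ (with the convention $0^0=1$), $$\xi_q(\cdot)=\frac{N}{(N-2)!}\sum_{t=1}^{q}\binom{N-1}{t-1}(-1)^{t+1}\sum_{i=0}^{N-2}\binom{N-2}{i}(1-t)^i\,i!\sum_{l=0}^{i}(\cdot),$$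 and, with $b_k=\frac{TN}{\rho(1/k-T)}$, $$C_1=\tfrac{(N-2)!}{(T+1)^{N-1}}\Big(1-e^{-(T+1)b_1}\sum_{l=0}^{N-2}\tfrac{(T+1)^lb_1^l}{l!}\Big),\qquad C_2=\tfrac{(N-2)!}{2^{N-1}}e^{-2b_1}\sum_{l=0}^{N-2}\tfrac{2^lb_1^l}{l!},$$ $$D_1=\sum_{v=0}^{l}\binom lv\Big(\tfrac N\rho\Big)^{l-v}\tfrac{(N-i+v-2)!}{(T+1)^{N-i+v-1}}\sum_{u=0}^{N-i+v-2}\tfrac{(T+1)^u}{u!}\Big(e^{-(T+1)b_{k-1}}b_{k-1}^u-e^{-(T+1)b_k}b_k^u\Big),$$ $$D_2=\tfrac{(N-i+l-2)!}{(\frac{k}{k-1})^{N-i+l-1}}\Big[e^{-\frac{k}{k-1}b_{k-1}}\sum_{u=0}^{N-i+l-2}\big(\tfrac{k}{k-1}\big)^u\tfrac{b_{k-1}^u}{u!}-e^{-\frac{k}{k-1}b_k}\sum_{u=0}^{N-i+l-2}\big(\tfrac{k}{k-1}\big)^u\tfrac{b_k^u}{u!}\Big],$$ $$E_1=\tfrac{(N-i+l-2)!}{(\frac{k+1}{k})^{N-i+l-1}}e^{-\frac{k+1}{k}b_k}\sum_{u=0}^{N-i+l-2}\big(\tfrac{k+1}{k}\big)^u\tfrac{b_k^u}{u!},\qquad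 E_2=\tfrac{(N-i+l-2)!}{(\frac{k}{k-1})^{N-i+l-1}}e^{-\frac{k}{k-1}b_k}\sum_{u=0}^{N-i+l-2}\big(\tfrac{k}{k-1}\big)^u\tfrac{b_k^u}{u!},$$ $$F_1=\sum_{v=0}^{l}\binom lv\Big(\tfrac N\rho\Big)^{l-v}\tfrac{(N-i+v-2)!}{(T+1)^{N-i+v-1}}e^{-(T+1)b_{m-1}}\sum_{u=0}^{N-i+v-2}(T+1)^u\tfrac{b_{m-1}^u}{u!},$$ $$F_2=\tfrac{(N-i+l-2)!}{(\frac{m}{m-1})^{N-i+l-1}}e^{-\frac{m}{m-1}b_{m-1}}\sum_{u=0}^{N-i+l-2}\big(\tfrac{m}{m-1}\big)^u\tfrac{b_{m-1}^u}{u!}.$$ -/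

import Mathlib

open MeasureTheory ProbabilityTheory
open scoped NNReal Nat

namespace ORP

noncomputable section

/-- The circularly symmetric complex Gaussian law `CN(0, v)`: real and imaginary parts are
independent real Gaussians with mean `0` and variance `v / 2`. -/
def circularGaussian (v : ℝ≥0) : Measure ℂ :=
  ((gaussianReal 0 (v / 2)).prod (gaussianReal 0 (v / 2))).map
    Complex.measurableEquivRealProd.symm

/-- Rayleigh fading: the coefficients `X i` are independent, each with law `CN(0, 1)`. -/
def IsRayleighFading {Ω ι : Type*} [MeasurableSpace Ω] (X : ι → Ω → ℂ) (μ : Measure Ω) : Prop :=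
  iIndepFun X μ ∧ ∀ i, HasLaw (X i) (circularGaussian 1) μ

/-- The power gain `|hᵀ p|²` of the beam `p` over the channel `h` (no conjugation of `h`). -/
def beamGain {Nt : ℕ} (h : Fin Nt → ℂ) (p : EuclideanSpace ℂ (Fin Nt)) : ℝ :=
  ‖∑ j, h j * p j‖ ^ 2

/-- The SINR of the `n`-th of the `N` simultaneously used beams `p`, for the channel `h` of one
receive antenna, total transmit power `PT` (so power `PT / N` per beam) and noise variance `σ2`. -/
def sinr {N Nt : ℕ} (PT σ2 : ℝ) (h : Fin Nt → ℂ) (p : Fin N → EuclideanSpace ℂ (Fin Nt))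
    (n : Fin N) : ℝ :=
  beamGain h (p n) * (PT / N) /
    (σ2 + ∑ i ∈ Finset.univ.erase n, beamGain h (p i) * (PT / N))

/-- Coverage probability of the scheme with `D` precoder groups and a single receive antenna: the
probability that the maximum SINR over all beams `n` and slots `d` exceeds `T`. The vector
`p ω n d` is the `n`-th beam of the group used in slot `d`; the channel is the same in all slots. -/
def coverageMPG {Ω : Type*} [MeasurableSpace Ω] {N D Nt : ℕ} (μ : Measure Ω) (PT σ2 T : ℝ)
    (h : Ω → Fin Nt → ℂ) (p : Ω → Fin N → Fin D → EuclideanSpace ℂ (Fin Nt)) : ℝ :=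
  μ.real {ω | T < ⨆ x : Fin N × Fin D, sinr PT σ2 (h ω) (fun i => p ω i x.2) x.1}

/-- Coverage probability of the scheme with `D` precoder groups and antenna selection among `Nr`
receive antennas: the maximum SINR is taken over beams, slots and receive antennas. Row `r` of
the channel matrix `H ω` is the channel of antenna `r`. -/
def coverageASMPG {Ω : Type*} [MeasurableSpace Ω] {N D Nt Nr : ℕ} (μ : Measure Ω)
    (PT σ2 T : ℝ) (H : Ω → Fin Nr → Fin Nt → ℂ)
    (p : Ω → Fin N → Fin D → EuclideanSpace ℂ (Fin Nt)) : ℝ :=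
  μ.real {ω | T < ⨆ x : Fin N × Fin D × Fin Nr,
    sinr PT σ2 (H ω x.2.2) (fun i => p ω i x.2.1) x.1}

/-! The closed form of the coverage probability for one slot and one receive antenna. It is only
used with `N ≥ 2` when `T < 1`, so that no natural-number subtraction below truncates. -/

/-- The points `b_k`. -/
def bPt (N : ℕ) (ρ T : ℝ) (k : ℕ) : ℝ := T * N / (ρ * (1 / k - T))

/-- The coefficient `C₁`. -/
def C1 (N : ℕ) (ρ T : ℝ) : ℝ :=
  (N - 2)! / (T + 1) ^ (N - 1) *
    (1 - Real.exp (-(T + 1) * bPt N ρ T 1) *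
      ∑ l ∈ Finset.range (N - 1), (T + 1) ^ l * bPt N ρ T 1 ^ l / l !)

/-- The coefficient `C₂`. -/
def C2 (N : ℕ) (ρ T : ℝ) : ℝ :=
  (N - 2)! / 2 ^ (N - 1) * Real.exp (-2 * bPt N ρ T 1) *
    ∑ l ∈ Finset.range (N - 1), 2 ^ l * bPt N ρ T 1 ^ l / l !

/-- The coefficient `D₁`. -/
def D1 (N : ℕ) (ρ T : ℝ) (k i l : ℕ) : ℝ :=
  ∑ v ∈ Finset.range (l + 1), (l.choose v : ℝ) * (N / ρ) ^ (l - v) *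
    ((N - i + v - 2)! / (T + 1) ^ (N - i + v - 1)) *
    ∑ u ∈ Finset.range (N - i + v - 1), (T + 1) ^ u / u ! *
      (Real.exp (-(T + 1) * bPt N ρ T (k - 1)) * bPt N ρ T (k - 1) ^ u -
        Real.exp (-(T + 1) * bPt N ρ T k) * bPt N ρ T k ^ u)

/-- The coefficient `D₂`. -/
def D2 (N : ℕ) (ρ T : ℝ) (k i l : ℕ) : ℝ :=
  (N - i + l - 2)! / ((k : ℝ) / (k - 1)) ^ (N - i + l - 1) *
    (Real.exp (-((k : ℝ) / (k - 1)) * bPt N ρ T (k - 1)) *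
        ∑ u ∈ Finset.range (N - i + l - 1),
          ((k : ℝ) / (k - 1)) ^ u * (bPt N ρ T (k - 1) ^ u / u !) -
      Real.exp (-((k : ℝ) / (k - 1)) * bPt N ρ T k) *
        ∑ u ∈ Finset.range (N - i + l - 1),
          ((k : ℝ) / (k - 1)) ^ u * (bPt N ρ T k ^ u / u !))

/-- The coefficient `E₁`. -/
def E1 (N : ℕ) (ρ T : ℝ) (k i l : ℕ) : ℝ :=
  (N - i + l - 2)! / (((k : ℝ) + 1) / k) ^ (N - i + l - 1) *
    Real.exp (-(((k : ℝ) + 1) / k) * bPt N ρ T k) *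
    ∑ u ∈ Finset.range (N - i + l - 1), (((k : ℝ) + 1) / k) ^ u * (bPt N ρ T k ^ u / u !)

/-- The coefficient `E₂`. -/
def E2 (N : ℕ) (ρ T : ℝ) (k i l : ℕ) : ℝ :=
  (N - i + l - 2)! / ((k : ℝ) / (k - 1)) ^ (N - i + l - 1) *
    Real.exp (-((k : ℝ) / (k - 1)) * bPt N ρ T k) *
    ∑ u ∈ Finset.range (N - i + l - 1), ((k : ℝ) / (k - 1)) ^ u * (bPt N ρ T k ^ u / u !)

/-- The coefficient `F₁`. -/
def F1 (N : ℕ) (ρ T : ℝ) (m i l : ℕ) : ℝ :=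
  ∑ v ∈ Finset.range (l + 1), (l.choose v : ℝ) * (N / ρ) ^ (l - v) *
    ((N - i + v - 2)! / (T + 1) ^ (N - i + v - 1)) *
    Real.exp (-(T + 1) * bPt N ρ T (m - 1)) *
    ∑ u ∈ Finset.range (N - i + v - 1), (T + 1) ^ u * (bPt N ρ T (m - 1) ^ u / u !)

/-- The coefficient `F₂`. -/
def F2 (N : ℕ) (ρ T : ℝ) (m i l : ℕ) : ℝ :=
  (N - i + l - 2)! / ((m : ℝ) / (m - 1)) ^ (N - i + l - 1) *
    Real.exp (-((m : ℝ) / (m - 1)) * bPt N ρ T (m - 1)) *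
    ∑ u ∈ Finset.range (N - i + l - 1),
      ((m : ℝ) / (m - 1)) ^ u * (bPt N ρ T (m - 1) ^ u / u !)

/-- The summation operator `ξ_q(·)`, applied to an expression `g` in the indices `i`, `l`. -/
def xi (N q : ℕ) (g : ℕ → ℕ → ℝ) : ℝ :=
  (N : ℝ) / (N - 2)! * ∑ t ∈ Finset.Icc 1 q, ((N - 1).choose (t - 1) : ℝ) * (-1) ^ (t + 1) *
    ∑ i ∈ Finset.range (N - 1), ((N - 2).choose i : ℝ) * (1 - (t : ℝ)) ^ i * i ! *
      ∑ l ∈ Finset.range (i + 1), g i l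

/-- The first summand. -/
def PFirst (N : ℕ) (ρ T : ℝ) : ℝ :=
  (N : ℝ) / (N - 2)! * (Real.exp (-(T * N / ρ)) * C1 N ρ T + C2 N ρ T)

/-- The middle summands. -/
def PMid (N : ℕ) (ρ T : ℝ) (k : ℕ) : ℝ :=
  xi N k (fun i l => Real.exp (-(T * N / ρ)) * (T ^ l / l !) * D1 N ρ T k i l -
      1 / (((k : ℝ) - 1) ^ l * l !) * D2 N ρ T k i l) +
    xi N k (fun i l => 1 / ((k : ℝ) ^ l * l !) * E1 N ρ T k i l -
      1 / (((k : ℝ) - 1) ^ l * l !) * E2 N ρ T k i l)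

/-- The last summand. -/
def PLast (N : ℕ) (ρ T : ℝ) (m : ℕ) : ℝ :=
  xi N m (fun i l => Real.exp (-(T * N / ρ)) * (T ^ l / l !) * F1 N ρ T m i l -
      1 / (((m : ℝ) - 1) ^ l * l !) * F2 N ρ T m i l)

open Classical in
/-- The closed-form expression `P_DL`, with `m = ⌈1 / T⌉` in the case `T < 1`. -/
def PDL (N : ℕ) (ρ T : ℝ) : ℝ :=
  if 1 ≤ T then (N : ℝ) / (T + 1) ^ (N - 1) * Real.exp (-(T * N / ρ))
  else PFirst N ρ T + ∑ k ∈ Finset.Icc 2 (⌈1 / T⌉₊ - 1), PMid N ρ T k + PLast N ρ T ⌈1 / T⌉₊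

end

end ORP

/-! Complex Gaussian vectors are unitarily invariant, so the gains of orthonormal beams over a
Rayleigh channel are i.i.d. standard exponentials (`map_gain_pi_circularGaussian`). Stacking the
rows of all antennas into one long channel vector keeps the beams orthonormal
(`orthonormal_antennas`). Hence, given the precoders, all gains over beams, slots and antennas are
independent, with a law that does not depend on the precoders. Coverage fails exactly when it fails
in each of `Nr * D` independent groups of `N` gains, which produces the power.

For one group, put `c = N / ρ`. The event that `j` given gains all exceed `T` times (`c` plus the
other gains) is, inside the positive orthant, the image of that orthant under an affine shear. A
change of variables gives its probability `jointProb`, which vanishes once `(j - 1) * T ≥ 1`.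
Inclusion-exclusion gives `coverSum` (`pi_expMeasure_exists`).

The expression `PDL` is organised differently (`PDL_eq_coverSum`). With `x` one gain and `y` the sum
of the others, its `k`-th summand integrates `exp (-x - y) * (y - s * x) ^ (N - 2)`, with signed
binomial weights over `s < k`, over the sector `(k - 1) * x ≤ y ≤ k * x` above the line `x = T * (c
+ y)`. For fixed `s` the sectors telescope (`sum_telescope`) to the whole wedge `s * x ≤ y`. The
integral over that wedge is elementary (`wedge_self`) and is, up to constants, the
inclusion-exclusion term with `j = s + 1`. -/

namespace ORP

/-! ### Incomplete Gamma integrals -/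

/-- Closed form of the upper incomplete Gamma integral `∫_b^∞ y ^ n * exp (-a * y)`. -/
noncomputable def gammaTail (n : ℕ) (a b : ℝ) : ℝ :=
  n ! / a ^ (n + 1) * Real.exp (-a * b) * ∑ u ∈ Finset.range (n + 1), a ^ u * (b ^ u / u !)

lemma gammaTail_zero_left (a b : ℝ) : gammaTail 0 a b = Real.exp (-a * b) / a := by
  simp [gammaTail]; ring

lemma gammaTail_succ (n : ℕ) {a : ℝ} (ha : a ≠ 0) (b : ℝ) :
    gammaTail (n + 1) a b =
      (n + 1) / a * gammaTail n a b + b ^ (n + 1) * Real.exp (-a * b) / a := by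
  unfold gammaTail
  rw [Finset.sum_range_succ _ (n + 1), Nat.factorial_succ]
  have h1 : (n ! : ℝ) ≠ 0 := by positivity
  have h2 : (n + 1 : ℝ) ≠ 0 := by positivity
  push_cast
  field_simp
  ring

lemma gammaTail_zero_right (n : ℕ) (a : ℝ) : gammaTail n a 0 = n ! / a ^ (n + 1) := by
  simp [gammaTail, Finset.sum_range_succ']

/-- Induction along the integration-by-parts recursion `gammaTail_succ`: the derivative of the
boundary term cancels the one inherited from `n`. -/
lemma hasDerivAt_gammaTail (n : ℕ) {a : ℝ} (ha : a ≠ 0) (b : ℝ) :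
    HasDerivAt (gammaTail n a) (-(b ^ n * Real.exp (-a * b))) b := by
  have he : HasDerivAt (fun y : ℝ => Real.exp (-a * y)) (Real.exp (-a * b) * (-a)) b := by
    simpa using ((hasDerivAt_id b).const_mul (-a)).exp
  induction n with
  | zero =>
    rw [show gammaTail 0 a = fun y => Real.exp (-a * y) / a from
      funext (gammaTail_zero_left a)]
    refine (he.div_const a).congr_deriv ?_
    rw [pow_zero, mul_neg, neg_div, mul_div_assoc, div_self ha]; ring
  | succ n ih =>
    rw [show gammaTail (n + 1) a = fun y => _ from funext (gammaTail_succ n ha)]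
    refine ((ih.const_mul ((n + 1 : ℝ) / a)).fun_add
      (((hasDerivAt_pow (n + 1) b).fun_mul he).div_const a)).congr_deriv ?_
    simp only [Nat.add_sub_cancel]
    push_cast
    field_simp
    ring

lemma hasDerivAt_neg_gammaTail (n : ℕ) {a : ℝ} (ha : a ≠ 0) (b : ℝ) :
    HasDerivAt (fun y => -gammaTail n a y) (b ^ n * Real.exp (-a * b)) b := by
  simpa only [neg_neg] using (hasDerivAt_gammaTail n ha b).fun_neg

lemma tendsto_gammaTail (n : ℕ) {a : ℝ} (ha : 0 < a) :
    Filter.Tendsto (gammaTail n a) Filter.atTop (nhds 0) := by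
  have hp (k : ℕ) : Filter.Tendsto (fun y : ℝ => y ^ k * Real.exp (-a * y))
      Filter.atTop (nhds 0) := by
    have h := ((Real.tendsto_pow_mul_exp_neg_atTop_nhds_zero k).comp
      (Filter.tendsto_id.const_mul_atTop ha)).const_mul ((a ^ k)⁻¹)
    rw [mul_zero] at h
    refine h.congr fun y => ?_
    have : a ^ k ≠ 0 := by positivity
    simp only [Function.comp_apply, id, mul_pow, neg_mul]
    field_simp
  have : gammaTail n a = fun b => ∑ u ∈ Finset.range (n + 1),
      (n ! / a ^ (n + 1) * a ^ u / u !) * (b ^ u * Real.exp (-a * b)) := by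
    funext b
    rw [gammaTail, Finset.mul_sum]
    exact Finset.sum_congr rfl fun u _ => by ring
  rw [this]
  have h := tendsto_finsetSum (Finset.range (n + 1)) fun u _ =>
    (hp u).const_mul (n ! / a ^ (n + 1) * a ^ u / u !)
  simpa using h

lemma integrableOn_pow_mul_exp (n : ℕ) {a b : ℝ} (ha : 0 < a) (hb : 0 ≤ b) :
    IntegrableOn (fun y : ℝ => y ^ n * Real.exp (-a * y)) (Set.Ioi b) := by
  refine integrableOn_Ioi_deriv_of_nonneg' (g := fun y => -gammaTail n a y) (l := 0)
    (fun x _ => ?_) (fun x hx => ?_) (by simpa using (tendsto_gammaTail n ha).neg)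
  · exact hasDerivAt_neg_gammaTail n ha.ne' x
  · have : 0 ≤ x := hb.trans (le_of_lt hx)
    positivity

lemma integral_Ioi_pow_mul_exp (n : ℕ) {a b : ℝ} (ha : 0 < a) (hb : 0 ≤ b) :
    ∫ y in Set.Ioi b, y ^ n * Real.exp (-a * y) = gammaTail n a b := by
  have := integral_Ioi_of_hasDerivAt_of_tendsto' (f := fun y => -gammaTail n a y) (m := 0)
    (a := b) (f' := fun y : ℝ => y ^ n * Real.exp (-a * y))
    (fun x _ => hasDerivAt_neg_gammaTail n ha.ne' x)
    (integrableOn_pow_mul_exp n ha hb) (by simpa using (tendsto_gammaTail n ha).neg)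
  simpa using this

lemma intervalIntegral_pow_mul_exp (n : ℕ) (x y : ℝ) :
    ∫ z in x..y, z ^ n * Real.exp (-z) = gammaTail n 1 x - gammaTail n 1 y := by
  have := intervalIntegral.integral_eq_sub_of_hasDerivAt (a := x) (b := y)
    (f := fun y => -gammaTail n 1 y) (f' := fun y : ℝ => y ^ n * Real.exp (-y))
    (fun z _ => by simpa using hasDerivAt_neg_gammaTail n one_ne_zero z)
    (Continuous.intervalIntegrable (by fun_prop) _ _)
  rw [this]; ring

/-! ### Closed form of the wedge integrals -/

/-- The summands of `wedge`. -/
noncomputable def wedgeTerm (n : ℕ) (c T r b : ℝ) (i l : ℕ) : ℝ :=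
  Real.exp (-(T * c)) * (T ^ l / l !) *
      (∑ v ∈ Finset.range (l + 1), (l.choose v : ℝ) * c ^ (l - v) *
        gammaTail (n - i + v) (T + 1) b) -
    1 / (r ^ l * l !) * gammaTail (n - i + l) (1 + 1 / r) b

/-- Closed form of `∫_b^∞ ∫_{T (c + y)}^{y / r} exp (-x - y) * (y - s * x) ^ n dx dy`. -/
noncomputable def wedge (n : ℕ) (c T s r b : ℝ) : ℝ :=
  ∑ i ∈ Finset.range (n + 1), (n.choose i : ℝ) * (-s) ^ i * i ! *
    ∑ l ∈ Finset.range (i + 1), wedgeTerm n c T r b i l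

/-- Expanding `(y - s * x) ^ n` in powers of `x` leaves Gamma integrals between the two endpoints.
At the lower endpoint `(c + y) ^ l` is expanded once more, so that everything becomes a combination
of powers of `y` times exponentials. -/
lemma intervalIntegral_wedge (n : ℕ) (c T s r y : ℝ) :
    ∫ x in (T * (c + y))..(y / r), Real.exp (-x - y) * (y - s * x) ^ n =
      ∑ i ∈ Finset.range (n + 1), (n.choose i : ℝ) * (-s) ^ i * i ! *
        ∑ l ∈ Finset.range (i + 1), (Real.exp (-(T * c)) * (T ^ l / l !) *
          (∑ v ∈ Finset.range (l + 1), (l.choose v : ℝ) * c ^ (l - v) *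
            (y ^ (n - i + v) * Real.exp (-(T + 1) * y))) -
          1 / (r ^ l * l !) * (y ^ (n - i + l) * Real.exp (-(1 + 1 / r) * y))) := by
  have h1 (x : ℝ) : Real.exp (-x - y) * (y - s * x) ^ n =
      ∑ i ∈ Finset.range (n + 1), (n.choose i : ℝ) * (-s) ^ i * y ^ (n - i) * Real.exp (-y) *
        (x ^ i * Real.exp (-x)) := by
    rw [sub_eq_add_neg (-x), Real.exp_add, show y - s * x = (-s) * x + y by ring, add_pow,
      Finset.mul_sum]
    refine Finset.sum_congr rfl fun i _ => ?_
    rw [mul_pow]; ring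
  simp_rw [h1]
  rw [intervalIntegral.integral_finsetSum
    (fun i _ => Continuous.intervalIntegrable (by fun_prop) _ _)]
  refine Finset.sum_congr rfl fun i _ => ?_
  rw [intervalIntegral.integral_const_mul, intervalIntegral_pow_mul_exp]
  unfold gammaTail
  have e1 : Real.exp (-(T * c)) * Real.exp (-(T + 1) * y) =
      Real.exp (-y) * Real.exp (-1 * (T * (c + y))) := by
    rw [← Real.exp_add, ← Real.exp_add]; ring_nf
  have e2 : Real.exp (-(1 + 1 / r) * y) = Real.exp (-y) * Real.exp (-1 * (y / r)) := by
    rw [← Real.exp_add]; ring_nf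
  simp only [one_pow, div_one, one_mul]
  have h2 : ∀ l ∈ Finset.range (i + 1), (Real.exp (-(T * c)) * (T ^ l / l !) *
          (∑ v ∈ Finset.range (l + 1), (l.choose v : ℝ) * c ^ (l - v) *
            (y ^ (n - i + v) * Real.exp (-(T + 1) * y))) -
          1 / (r ^ l * l !) * (y ^ (n - i + l) * Real.exp (-(1 + 1 / r) * y))) =
      y ^ (n - i) * Real.exp (-y) * (Real.exp (-1 * (T * (c + y))) * ((T * (c + y)) ^ l / l !)
        - Real.exp (-1 * (y / r)) * ((y / r) ^ l / l !)) := by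
    intro l _
    have h3 : (∑ v ∈ Finset.range (l + 1), (l.choose v : ℝ) * c ^ (l - v) *
            (y ^ (n - i + v) * Real.exp (-(T + 1) * y))) =
        y ^ (n - i) * Real.exp (-(T + 1) * y) * (c + y) ^ l := by
      rw [add_comm c y, add_pow, Finset.mul_sum]
      refine Finset.sum_congr rfl fun v _ => ?_
      rw [pow_add]; ring
    rw [h3, e2, mul_pow, div_pow, pow_add]
    calc _ = (Real.exp (-(T * c)) * Real.exp (-(T + 1) * y)) *
          (T ^ l / l ! * y ^ (n - i) * (c + y) ^ l) -
          1 / (r ^ l * l !) * (y ^ (n - i) * y ^ l * (Real.exp (-y) * Real.exp (-1 * (y / r)))) := by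
          ring
      _ = _ := by rw [e1]; field_simp
  rw [Finset.sum_congr rfl h2, ← Finset.mul_sum, Finset.sum_sub_distrib, ← Finset.mul_sum,
    ← Finset.mul_sum]
  ring

lemma integrableOn_and_integral_eq_wedge (n : ℕ) {c T s r b : ℝ} (hT : 0 < T) (hr : 0 < r) (hb : 0 ≤ b) :
    IntegrableOn (fun y => ∫ x in (T * (c + y))..(y / r), Real.exp (-x - y) * (y - s * x) ^ n)
      (Set.Ioi b) ∧
    ∫ y in Set.Ioi b, ∫ x in (T * (c + y))..(y / r), Real.exp (-x - y) * (y - s * x) ^ n =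
      wedge n c T s r b := by
  have hT1 : 0 < T + 1 := by linarith
  have hr1 : 0 < 1 + 1 / r := by positivity
  simp_rw [intervalIntegral_wedge]
  have i1 (k : ℕ) := integrableOn_pow_mul_exp k hT1 hb
  have i2 (k : ℕ) := integrableOn_pow_mul_exp k hr1 hb
  have i3 (i l : ℕ) : IntegrableOn (fun y => ∑ v ∈ Finset.range (l + 1),
      (l.choose v : ℝ) * c ^ (l - v) * (y ^ (n - i + v) * Real.exp (-(T + 1) * y)))
      (Set.Ioi b) :=
    integrable_finsetSum _ fun v _ => (i1 _).const_mul _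
  have i4 (i l : ℕ) : IntegrableOn (fun y => (Real.exp (-(T * c)) * (T ^ l / l !) *
          (∑ v ∈ Finset.range (l + 1), (l.choose v : ℝ) * c ^ (l - v) *
            (y ^ (n - i + v) * Real.exp (-(T + 1) * y))) -
          1 / (r ^ l * l !) * (y ^ (n - i + l) * Real.exp (-(1 + 1 / r) * y))))
      (Set.Ioi b) := ((i3 i l).const_mul _).sub ((i2 _).const_mul _)
  have i5 (i : ℕ) := integrable_finsetSum (Finset.range (i + 1)) fun l _ => i4 i l
  refine ⟨integrable_finsetSum _ fun i _ => (i5 i).const_mul _, ?_⟩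
  rw [integral_finsetSum _ fun i _ => (i5 i).const_mul _]
  refine Finset.sum_congr rfl fun i _ => ?_
  rw [integral_const_mul, integral_finsetSum _ fun l _ => i4 i l]
  congr 1
  refine Finset.sum_congr rfl fun l _ => ?_
  rw [wedgeTerm, integral_sub ((i3 i l).const_mul _) ((i2 _).const_mul _), integral_const_mul,
    integral_const_mul, integral_finsetSum _ fun v _ => (i1 _).const_mul _,
    integral_Ioi_pow_mul_exp _ hr1 hb]
  congr 2
  refine Finset.sum_congr rfl fun v _ => ?_
  rw [integral_const_mul, integral_Ioi_pow_mul_exp _ hT1 hb]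

/-! ### The diagonal wedge integral in elementary form -/

lemma lintegral_Ioi_pow_mul_exp (n : ℕ) {a : ℝ} (ha : 0 < a) :
    ∫⁻ y in Set.Ioi 0, ENNReal.ofReal (y ^ n * Real.exp (-a * y)) =
      ENNReal.ofReal (n ! / a ^ (n + 1)) := by
  rw [← gammaTail_zero_right, ← integral_Ioi_pow_mul_exp n ha le_rfl,
    ofReal_integral_eq_lintegral_ofReal (integrableOn_pow_mul_exp n ha le_rfl)]
  refine (ae_restrict_mem measurableSet_Ioi).mono fun x (hx : 0 < x) => ?_
  simp only [Pi.zero_apply]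
  positivity

lemma lintegral_Ioi_exp {a : ℝ} (ha : 0 < a) (b : ℝ) :
    ∫⁻ y in Set.Ioi b, ENNReal.ofReal (Real.exp (-a * y)) =
      ENNReal.ofReal (Real.exp (-a * b) / a) := by
  have h : IntegrableOn (fun y => Real.exp (-a * y)) (Set.Ioi b) :=
    integrableOn_exp_mul_Ioi (by linarith) b
  rw [← ofReal_integral_eq_lintegral_ofReal h (Filter.Eventually.of_forall fun _ => by
    simp only [Pi.zero_apply]; positivity), integral_exp_mul_Ioi (by linarith) b]
  congr 1
  rw [neg_div_neg_eq]

/-- The point `s * T * c / (1 - s * T)` is where the lines `x = T * (c + y)` and `x = y / s` cross,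
so the inner interval is nonempty exactly beyond it. On the region `y - s * x ≥ 0`, so the signed
integral is a Lebesgue integral of a nonnegative function. -/
lemma wedge_self_eq_lintegral (n : ℕ) {c T s : ℝ} (hc : 0 < c) (hT : 0 < T) (hs : 0 < s)
    (hsT : s * T < 1) :
    ENNReal.ofReal (wedge n c T s s (s * T * c / (1 - s * T))) =
      ∫⁻ y, ∫⁻ x, {q : ℝ × ℝ | T * (c + q.2) < q.1 ∧ s * q.1 ≤ q.2}.indicator
        (fun q => ENNReal.ofReal (Real.exp (-q.1 - q.2) * (q.2 - s * q.1) ^ n)) (x, y) := by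
  have h1 : 0 < 1 - s * T := by linarith
  set b := s * T * c / (1 - s * T) with hb
  have hb0 : 0 ≤ b := by positivity
  obtain ⟨hint, heq⟩ := integrableOn_and_integral_eq_wedge (c := c) (s := s) n hT hs hb0
  have hle (y : ℝ) : T * (c + y) < y / s ↔ b < y := by
    rw [hb, lt_div_iff₀ hs, div_lt_iff₀ h1]
    constructor <;> intro h <;> nlinarith
  have hpos (x y : ℝ) (hx : x ≤ y / s) : 0 ≤ Real.exp (-x - y) * (y - s * x) ^ n := by
    have : s * x ≤ y := by rw [le_div_iff₀ hs] at hx; linarith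
    have : 0 ≤ y - s * x := by linarith
    positivity
  rw [← heq, ofReal_integral_eq_lintegral_ofReal hint]
  · rw [← lintegral_indicator measurableSet_Ioi]
    congr 1 with y
    have hset : (fun x => {q : ℝ × ℝ | T * (c + q.2) < q.1 ∧ s * q.1 ≤ q.2}.indicator
        (fun q => ENNReal.ofReal (Real.exp (-q.1 - q.2) * (q.2 - s * q.1) ^ n)) (x, y)) =
        (Set.Ioc (T * (c + y)) (y / s)).indicator
          (fun x => ENNReal.ofReal (Real.exp (-x - y) * (y - s * x) ^ n)) := by
      funext x
      simp only [Set.indicator, Set.mem_ofPred_eq, Set.mem_Ioc, le_div_iff₀ hs, mul_comm s x]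
    rw [hset, lintegral_indicator measurableSet_Ioc]
    by_cases hy : b < y
    · rw [Set.indicator_of_mem (show y ∈ Set.Ioi b from hy),
        intervalIntegral.integral_of_le ((hle y).2 hy).le,
        ofReal_integral_eq_lintegral_ofReal]
      · exact (Continuous.integrableOn_Icc (by fun_prop)).mono_set Set.Ioc_subset_Icc_self
      · exact (ae_restrict_mem measurableSet_Ioc).mono fun x hx => hpos x y hx.2
    · rw [Set.indicator_of_notMem (show y ∉ Set.Ioi b from hy), Set.Ioc_eq_empty (by rwa [hle])]
      simp
  · refine (ae_restrict_mem measurableSet_Ioi).mono fun y hy => ?_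
    refine intervalIntegral.integral_nonneg ((hle y).2 hy).le
      fun x hx => hpos x y hx.2

lemma lintegral_wedge_eq (n : ℕ) {c T s : ℝ} (hT : 0 < T) (hs : 0 < s)
    (hsT : s * T < 1) :
    ∫⁻ y, ∫⁻ x, {q : ℝ × ℝ | T * (c + q.2) < q.1 ∧ s * q.1 ≤ q.2}.indicator
        (fun q => ENNReal.ofReal (Real.exp (-q.1 - q.2) * (q.2 - s * q.1) ^ n)) (x, y) =
      ENNReal.ofReal (n ! / (1 + s) * ((1 - s * T) / (1 + T)) ^ (n + 1) *
        Real.exp (-((1 + s) * T * c / (1 - s * T)))) := by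
  have h1 : 0 < 1 - s * T := by linarith
  have h2 : 0 < 1 + s := by linarith
  have hA : MeasurableSet {q : ℝ × ℝ | T * (c + q.2) < q.1 ∧ s * q.1 ≤ q.2} := by
    have h3 : MeasurableSet {q : ℝ × ℝ | T * (c + q.2) < q.1} :=
      measurableSet_lt (by fun_prop) (by fun_prop)
    have h4 : MeasurableSet {q : ℝ × ℝ | s * q.1 ≤ q.2} :=
      measurableSet_le (by fun_prop) (by fun_prop)
    exact h3.inter h4
  have hmeas : Measurable ({q : ℝ × ℝ | T * (c + q.2) < q.1 ∧ s * q.1 ≤ q.2}.indicator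
        (fun q => ENNReal.ofReal (Real.exp (-q.1 - q.2) * (q.2 - s * q.1) ^ n))) :=
    (by fun_prop : Measurable fun q : ℝ × ℝ =>
      ENNReal.ofReal (Real.exp (-q.1 - q.2) * (q.2 - s * q.1) ^ n)).indicator hA
  rw [lintegral_lintegral_swap]
  swap
  · exact (hmeas.comp measurable_swap).aemeasurable
  -- Substituting `y = z + s * x` turns the polynomial into `z ^ n` and the constraint `s * x ≤ y`
  -- into `0 ≤ z`, both free of `x`. The integral over `x` is then purely exponential and the one
  -- over `z` is a Gamma integral.
  have hshift (x : ℝ) : ∫⁻ y, {q : ℝ × ℝ | T * (c + q.2) < q.1 ∧ s * q.1 ≤ q.2}.indicator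
        (fun q => ENNReal.ofReal (Real.exp (-q.1 - q.2) * (q.2 - s * q.1) ^ n)) (x, y) =
      ∫⁻ z, {q : ℝ × ℝ | T * (c + q.2) < q.1 ∧ s * q.1 ≤ q.2}.indicator
        (fun q => ENNReal.ofReal (Real.exp (-q.1 - q.2) * (q.2 - s * q.1) ^ n))
          (x, z + s * x) :=
    (lintegral_add_right_eq_self _ (s * x)).symm
  simp_rw [hshift]
  rw [lintegral_lintegral_swap]
  swap
  · exact (hmeas.comp (by fun_prop : Measurable fun q : ℝ × ℝ => (q.1, q.2 + s * q.1))).aemeasurable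
  have hinner (z : ℝ) : ∫⁻ x, {q : ℝ × ℝ | T * (c + q.2) < q.1 ∧ s * q.1 ≤ q.2}.indicator
        (fun q => ENNReal.ofReal (Real.exp (-q.1 - q.2) * (q.2 - s * q.1) ^ n))
          (x, z + s * x) =
      (Set.Ici 0).indicator (fun z => ENNReal.ofReal (Real.exp (-((1 + s) * T * c / (1 - s * T)))
        / (1 + s)) * ENNReal.ofReal (z ^ n * Real.exp (-((1 + T) / (1 - s * T)) * z))) z := by
    by_cases hz : 0 ≤ z
    · rw [Set.indicator_of_mem (show z ∈ Set.Ici 0 from hz)]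
      have : (fun x => {q : ℝ × ℝ | T * (c + q.2) < q.1 ∧ s * q.1 ≤ q.2}.indicator
        (fun q => ENNReal.ofReal (Real.exp (-q.1 - q.2) * (q.2 - s * q.1) ^ n))
          (x, z + s * x)) = (Set.Ioi (T * (c + z) / (1 - s * T))).indicator (fun x =>
            ENNReal.ofReal (z ^ n * Real.exp (-z)) *
              ENNReal.ofReal (Real.exp (-(1 + s) * x))) := by
        funext x
        have hiff : (T * (c + (z + s * x)) < x ∧ s * x ≤ z + s * x) ↔
            T * (c + z) / (1 - s * T) < x := by
          rw [div_lt_iff₀ h1]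
          exact ⟨fun h => by nlinarith [h.1], fun h => ⟨by nlinarith, by linarith⟩⟩
        simp only [Set.indicator, Set.mem_ofPred_eq, Set.mem_Ioi, hiff]
        split_ifs
        · rw [← ENNReal.ofReal_mul (by positivity)]
          congr 1
          rw [add_sub_cancel_right, mul_comm, mul_assoc, ← Real.exp_add]
          congr 2
          ring
        · rfl
      rw [this, lintegral_indicator measurableSet_Ioi,
        lintegral_const_mul _ (by fun_prop), lintegral_Ioi_exp h2,
        ← ENNReal.ofReal_mul (by positivity), ← ENNReal.ofReal_mul (by positivity)]
      congr 1
      have : Real.exp (-z) * Real.exp (-(1 + s) * (T * (c + z) / (1 - s * T))) =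
          Real.exp (-((1 + s) * T * c / (1 - s * T))) *
            Real.exp (-((1 + T) / (1 - s * T)) * z) := by
        rw [← Real.exp_add, ← Real.exp_add]
        congr 1
        field_simp
        ring
      calc _ = z ^ n / (1 + s) *
            (Real.exp (-z) * Real.exp (-(1 + s) * (T * (c + z) / (1 - s * T)))) := by ring
        _ = _ := by rw [this]; ring
    · rw [Set.indicator_of_notMem (show z ∉ Set.Ici 0 from hz)]
      have : (fun x => {q : ℝ × ℝ | T * (c + q.2) < q.1 ∧ s * q.1 ≤ q.2}.indicator
        (fun q => ENNReal.ofReal (Real.exp (-q.1 - q.2) * (q.2 - s * q.1) ^ n))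
          (x, z + s * x)) = fun _ => 0 := by
        funext x
        refine Set.indicator_of_notMem (fun h => hz ?_) _
        have := h.2
        simp only at this
        linarith
      rw [this, lintegral_zero]
  simp_rw [hinner]
  rw [lintegral_indicator measurableSet_Ici, lintegral_const_mul _ (by fun_prop),
    setLIntegral_congr Ioi_ae_eq_Ici.symm, lintegral_Ioi_pow_mul_exp n (by positivity),
    ← ENNReal.ofReal_mul (by positivity)]
  congr 1
  rw [div_pow, div_pow]
  field_simp

lemma wedge_self (n : ℕ) {c T s : ℝ} (hc : 0 < c) (hT : 0 < T) (hs : 0 < s)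
    (hsT : s * T < 1) :
    wedge n c T s s (s * T * c / (1 - s * T)) =
      n ! / (1 + s) * ((1 - s * T) / (1 + T)) ^ (n + 1) *
        Real.exp (-((1 + s) * T * c / (1 - s * T))) := by
  have h1 : 0 < 1 - s * T := by linarith
  have h := (wedge_self_eq_lintegral n hc hT hs hsT).trans (lintegral_wedge_eq n hT hs hsT)
  have hpos : 0 < n ! / (1 + s) * ((1 - s * T) / (1 + T)) ^ (n + 1) *
        Real.exp (-((1 + s) * T * c / (1 - s * T))) := by positivity
  -- `ENNReal.ofReal` truncates negative numbers, so the sign of the wedge has to be read off from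
  -- the positive right-hand side before cancelling.
  have h0 : 0 < wedge n c T s s (s * T * c / (1 - s * T)) := by
    rw [← ENNReal.ofReal_pos, h]; exact ENNReal.ofReal_pos.2 hpos
  exact (ENNReal.ofReal_eq_ofReal_iff h0.le hpos.le).1 h

/-! ### The closed form as an inclusion-exclusion sum -/

/-- The probability that `j` given beams out of `N` all have SINR larger than `T`, when the beam
gains are independent standard exponentials and the normalized noise is `c`. -/
noncomputable def jointProb (N : ℕ) (c T : ℝ) (j : ℕ) : ℝ :=
  if ((j : ℝ) - 1) * T < 1 then
    ((1 - ((j : ℝ) - 1) * T) / (1 + T)) ^ (N - 1) *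
      Real.exp (-(j * T * c / (1 - ((j : ℝ) - 1) * T)))
  else 0

/-- The probability that some beam out of `N` has SINR larger than `T`, as given by the
inclusion-exclusion formula. -/
noncomputable def coverSum (N : ℕ) (c T : ℝ) : ℝ :=
  ∑ j ∈ Finset.Icc 1 N, (N.choose j : ℝ) * (-1) ^ (j + 1) * jointProb N c T j

lemma sum_Icc_one_eq_sum_range (q : ℕ) (f : ℕ → ℝ) :
    ∑ j ∈ Finset.Icc 1 q, f j = ∑ s ∈ Finset.range q, f (s + 1) := by
  rw [Finset.range_eq_Ico, Finset.sum_Ico_add' f 0 q 1]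
  rfl

lemma xi_eq (n q : ℕ) (g : ℕ → ℕ → ℝ) :
    xi (n + 2) q g = (n + 2 : ℕ) / n ! * ∑ s ∈ Finset.range q, ((n + 1).choose s : ℝ) * (-1) ^ s *
      ∑ i ∈ Finset.range (n + 1), (n.choose i : ℝ) * (-(s : ℝ)) ^ i * i ! *
        ∑ l ∈ Finset.range (i + 1), g i l := by
  rw [xi, sum_Icc_one_eq_sum_range]
  have h1 : n + 2 - 1 = n + 1 := rfl
  simp only [Nat.add_sub_cancel, h1]
  congr 1
  refine Finset.sum_congr rfl fun s _ => ?_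
  have h2 : (1 : ℝ) - ((s + 1 : ℕ) : ℝ) = -s := by push_cast; ring
  rw [h2, pow_add, pow_add]
  norm_num

/-- The bound `i ≤ n` keeps the natural-number subtractions in the coefficients from truncating. -/
lemma xi_eq_of_wedgeTerm {n q : ℕ} {c T r b : ℝ} {g : ℕ → ℕ → ℝ}
    (h : ∀ i ≤ n, ∀ l, g i l = wedgeTerm n c T r b i l) :
    xi (n + 2) q g = (n + 2 : ℕ) / n ! * ∑ s ∈ Finset.range q, ((n + 1).choose s : ℝ) * (-1) ^ s *
      wedge n c T s r b := by
  rw [xi_eq]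
  congr 1
  refine Finset.sum_congr rfl fun s _ => ?_
  congr 1
  refine Finset.sum_congr rfl fun i hi => ?_
  congr 1
  exact Finset.sum_congr rfl fun l _ => h i (Nat.lt_succ_iff.1 (Finset.mem_range.1 hi)) l

lemma xi_add (N q : ℕ) (g g' : ℕ → ℕ → ℝ) :
    xi N q g + xi N q g' = xi N q (fun i l => g i l + g' i l) := by
  simp only [xi, Finset.sum_add_distrib, mul_add]

lemma xi_sub (N q : ℕ) (g g' : ℕ → ℕ → ℝ) :
    xi N q g - xi N q g' = xi N q (fun i l => g i l - g' i l) := by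
  simp only [xi, Finset.sum_sub_distrib, mul_sub]

lemma xi_congr {n q : ℕ} {g g' : ℕ → ℕ → ℝ} (h : ∀ i ≤ n, ∀ l, g i l = g' i l) :
    xi (n + 2) q g = xi (n + 2) q g' := by
  rw [xi_eq, xi_eq]
  congr 1
  refine Finset.sum_congr rfl fun s _ => ?_
  congr 1
  refine Finset.sum_congr rfl fun i hi => ?_
  congr 1
  exact Finset.sum_congr rfl fun l _ => h i (Nat.lt_succ_iff.1 (Finset.mem_range.1 hi)) l

lemma D1_eq (n : ℕ) (ρ T : ℝ) (k i l : ℕ) (hi : i ≤ n) :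
    D1 (n + 2) ρ T k i l =
      (∑ v ∈ Finset.range (l + 1), (l.choose v : ℝ) * ((n + 2 : ℕ) / ρ) ^ (l - v) *
        gammaTail (n - i + v) (T + 1) (bPt (n + 2) ρ T (k - 1))) -
      ∑ v ∈ Finset.range (l + 1), (l.choose v : ℝ) * ((n + 2 : ℕ) / ρ) ^ (l - v) *
        gammaTail (n - i + v) (T + 1) (bPt (n + 2) ρ T k) := by
  rw [D1, ← Finset.sum_sub_distrib]
  refine Finset.sum_congr rfl fun v _ => ?_
  have h1 : n + 2 - i + v - 2 = n - i + v := by omega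
  have h2 : n + 2 - i + v - 1 = n - i + v + 1 := by omega
  rw [h1, h2, ← mul_sub, gammaTail, gammaTail]
  simp only [mul_sub, Finset.sum_sub_distrib, Finset.mul_sum]
  congr 1 <;> exact Finset.sum_congr rfl fun u _ => by ring

lemma F1_eq (n : ℕ) (ρ T : ℝ) (k i l : ℕ) (hi : i ≤ n) :
    F1 (n + 2) ρ T k i l =
      ∑ v ∈ Finset.range (l + 1), (l.choose v : ℝ) * ((n + 2 : ℕ) / ρ) ^ (l - v) *
        gammaTail (n - i + v) (T + 1) (bPt (n + 2) ρ T (k - 1)) := by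
  refine Finset.sum_congr rfl fun v _ => ?_
  have h1 : n + 2 - i + v - 2 = n - i + v := by omega
  have h2 : n + 2 - i + v - 1 = n - i + v + 1 := by omega
  rw [h1, h2, gammaTail]
  ring

lemma E1_eq (n : ℕ) (ρ T : ℝ) {k : ℕ} (hk : 1 ≤ k) (i l : ℕ) (hi : i ≤ n) :
    E1 (n + 2) ρ T k i l = gammaTail (n - i + l) (1 + 1 / k) (bPt (n + 2) ρ T k) := by
  have h1 : n + 2 - i + l - 2 = n - i + l := by omega
  have h2 : n + 2 - i + l - 1 = n - i + l + 1 := by omega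
  have h0 : (k : ℝ) ≠ 0 := by positivity
  have h3 : ((k : ℝ) + 1) / k = 1 + 1 / k := by field_simp
  rw [E1, h1, h2, h3, gammaTail]

lemma succ_div_eq {k : ℕ} (hk : 1 ≤ k) :
    ((k + 1 : ℕ) : ℝ) / ((k + 1 : ℕ) - 1) = 1 + 1 / k := by
  have h0 : (k : ℝ) ≠ 0 := by positivity
  push_cast
  rw [add_sub_cancel_right]
  field_simp

/-- The first term integrates between consecutive points `b_k` and `b_{k+1}`, the second beyond
`b_{k+1}`, with the same integrand. -/
lemma D2_add_E2_eq (n : ℕ) (ρ T : ℝ) {k : ℕ} (hk : 1 ≤ k) (i l : ℕ) (hi : i ≤ n) :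
    D2 (n + 2) ρ T (k + 1) i l + E2 (n + 2) ρ T (k + 1) i l =
      gammaTail (n - i + l) (1 + 1 / k) (bPt (n + 2) ρ T k) := by
  have h1 : n + 2 - i + l - 2 = n - i + l := by omega
  have h2 : n + 2 - i + l - 1 = n - i + l + 1 := by omega
  rw [D2, E2, h1, h2, succ_div_eq hk, gammaTail, Nat.add_sub_cancel]
  ring

lemma F2_eq (n : ℕ) (ρ T : ℝ) {k : ℕ} (hk : 1 ≤ k) (i l : ℕ) (hi : i ≤ n) :
    F2 (n + 2) ρ T (k + 1) i l =
      gammaTail (n - i + l) (1 + 1 / k) (bPt (n + 2) ρ T k) := by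
  have h1 : n + 2 - i + l - 2 = n - i + l := by omega
  have h2 : n + 2 - i + l - 1 = n - i + l + 1 := by omega
  rw [F2, h1, h2, succ_div_eq hk, gammaTail, Nat.add_sub_cancel]

lemma PLast_eq (n : ℕ) (ρ T : ℝ) {k : ℕ} (hk : 1 ≤ k) :
    PLast (n + 2) ρ T (k + 1) = (n + 2 : ℕ) / n ! * ∑ s ∈ Finset.range (k + 1),
      ((n + 1).choose s : ℝ) * (-1) ^ s *
        wedge n ((n + 2 : ℕ) / ρ) T s k (bPt (n + 2) ρ T k) := by
  refine xi_eq_of_wedgeTerm fun i hi l => ?_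
  rw [F1_eq n ρ T _ i l hi, F2_eq n ρ T hk i l hi, wedgeTerm, Nat.add_sub_cancel, mul_div_assoc]
  push_cast
  rw [add_sub_cancel_right]

/-- The `D` terms cover the part of the sector with `y` between `b_k` and `b_{k+1}`, bounded below
by `x = T * (c + y)`. The `E` terms cover the part beyond `b_{k+1}`, where the lower boundary is `x
= y / (k + 1)`. Together they are a difference of two wedges. -/
lemma PMid_eq (n : ℕ) (ρ T : ℝ) {k : ℕ} (hk : 1 ≤ k) :
    PMid (n + 2) ρ T (k + 1) = (n + 2 : ℕ) / n ! * (∑ s ∈ Finset.range (k + 1),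
      ((n + 1).choose s : ℝ) * (-1) ^ s *
        (wedge n ((n + 2 : ℕ) / ρ) T s k (bPt (n + 2) ρ T k) -
          wedge n ((n + 2 : ℕ) / ρ) T s (k + 1 : ℕ) (bPt (n + 2) ρ T (k + 1)))) := by
  have h : PMid (n + 2) ρ T (k + 1) =
      xi (n + 2) (k + 1) (fun i l => wedgeTerm n ((n + 2 : ℕ) / ρ) T k (bPt (n + 2) ρ T k) i l) -
      xi (n + 2) (k + 1) (fun i l => wedgeTerm n ((n + 2 : ℕ) / ρ) T (k + 1 : ℕ)
        (bPt (n + 2) ρ T (k + 1)) i l) := by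
    rw [PMid, xi_add, xi_sub]
    refine xi_congr fun i hi l => ?_
    rw [D1_eq n ρ T _ i l hi, E1_eq n ρ T (by omega) i l hi, wedgeTerm, wedgeTerm,
      ← D2_add_E2_eq n ρ T hk i l hi, Nat.add_sub_cancel, mul_div_assoc]
    have : ((k + 1 : ℕ) : ℝ) - 1 = k := by push_cast; ring
    rw [this]
    ring
  rw [h, xi_eq_of_wedgeTerm (fun i _ l => rfl), xi_eq_of_wedgeTerm (fun i _ l => rfl), ← mul_sub,
    ← Finset.sum_sub_distrib]
  congr 1
  exact Finset.sum_congr rfl fun s _ => by ring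

lemma wedge_zero (n : ℕ) (c T r b : ℝ) :
    wedge n c T 0 r b =
      Real.exp (-(T * c)) * gammaTail n (T + 1) b - gammaTail n (1 + 1 / r) b := by
  rw [wedge, Finset.sum_eq_single 0]
  · simp [wedgeTerm]
  · intro i _ hi
    simp [hi]
  · simp

lemma PFirst_eq (n : ℕ) (ρ T : ℝ) :
    PFirst (n + 2) ρ T = (n + 2 : ℕ) / n ! *
      (Real.exp (-(T * ((n + 2 : ℕ) / ρ))) * (n ! / (T + 1) ^ (n + 1)) -
        wedge n ((n + 2 : ℕ) / ρ) T 0 1 (bPt (n + 2) ρ T 1)) := by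
  have h1 : n + 2 - 1 = n + 1 := rfl
  have hC1 : C1 (n + 2) ρ T =
      n ! / (T + 1) ^ (n + 1) - gammaTail n (T + 1) (bPt (n + 2) ρ T 1) := by
    rw [C1, gammaTail, h1, Nat.add_sub_cancel, mul_sub, mul_one, ← mul_assoc]
    congr 2
    exact Finset.sum_congr rfl fun u _ => by ring
  have hC2 : C2 (n + 2) ρ T = gammaTail n (1 + 1 / 1) (bPt (n + 2) ρ T 1) := by
    rw [C2, gammaTail, h1, Nat.add_sub_cancel]
    norm_num
    left
    exact Finset.sum_congr rfl fun u _ => by ring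
  rw [PFirst, hC1, hC2, wedge_zero, Nat.add_sub_cancel, mul_div_assoc]
  ring

/-- For fixed `s` the differences run over `k ≥ s`, so only the starting value `Z s s` survives. -/
lemma sum_telescope (w : ℕ → ℝ) (Z : ℕ → ℕ → ℝ) (m : ℕ) :
    ∑ k ∈ Finset.range m, ∑ s ∈ Finset.range (k + 1), w s * (Z s k - Z s (k + 1)) +
      ∑ s ∈ Finset.range (m + 1), w s * Z s m = ∑ s ∈ Finset.range (m + 1), w s * Z s s := by
  induction m with
  | zero => simp
  | succ m ih =>
    rw [Finset.sum_range_succ (fun s => w s * Z s s), ← ih, Finset.sum_range_succ,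
      Finset.sum_range_succ (fun s => w s * Z s (m + 1))]
    simp only [mul_sub, Finset.sum_sub_distrib]
    ring

/-- Absorbs the factor `1 / (1 + s)` of the diagonal wedge into the inclusion-exclusion binomial. -/
lemma choose_mul_div (n s : ℕ) :
    ((n + 2 : ℕ) : ℝ) * ((n + 1).choose s : ℝ) / (1 + s) = ((n + 2).choose (s + 1) : ℝ) := by
  have h := Nat.add_one_mul_choose_eq (n + 1) s
  rw [div_eq_iff (by positivity)]
  have h' : (((n + 1 + 1) * (n + 1).choose s : ℕ) : ℝ) =
    (((n + 1 + 1).choose (s + 1) * (s + 1) : ℕ) : ℝ) := by rw [h]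
  push_cast at h' ⊢
  linarith

theorem PDL_eq_coverSum {N : ℕ} {ρ T : ℝ} (hN : 1 ≤ N) (hρ : 0 < ρ) (hT : 0 < T)
    (hTN : 1 ≤ T ∨ 2 ≤ N) : PDL N ρ T = coverSum N (N / ρ) T := by
  by_cases hT1 : 1 ≤ T
  -- For `T ≥ 1` two beams cannot both exceed the threshold, so only `j = 1` contributes.
  · rw [PDL, if_pos hT1, coverSum, Finset.sum_eq_single 1]
    · simp [jointProb, mul_div_assoc, add_comm]
      ring
    · intro j hj hj1
      have h2 : 2 ≤ j := by
        have := (Finset.mem_Icc.1 hj).1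
        omega
      have h3 : (2 : ℝ) ≤ j := by exact_mod_cast h2
      rw [jointProb, if_neg (by nlinarith), mul_zero]
    · intro h
      exact absurd (Finset.mem_Icc.2 ⟨le_rfl, hN⟩) h
  · have h2N : 2 ≤ N := hTN.resolve_left hT1
    obtain ⟨n, rfl⟩ : ∃ n, N = n + 2 := ⟨N - 2, by omega⟩
    push Not at hT1
    obtain ⟨m, hm1, hm⟩ : ∃ m, 1 ≤ m ∧ ⌈1 / T⌉₊ = m + 1 := by
      have : 1 < ⌈1 / T⌉₊ := by
        rw [Nat.lt_ceil, lt_div_iff₀ hT]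
        simpa using hT1
      exact ⟨⌈1 / T⌉₊ - 1, by omega, by omega⟩
    have hlt (s : ℕ) : s < m + 1 ↔ s * T < 1 := by
      rw [← hm, Nat.lt_ceil, lt_div_iff₀ hT]
    set c : ℝ := (n + 2 : ℕ) / ρ with hc
    have hc0 : 0 < c := by positivity
    set w : ℕ → ℝ := fun s => ((n + 1).choose s : ℝ) * (-1) ^ s with hw
    -- At `k = 0` the upper limit `y / k` stands for infinity. This value only occurs with `s = 0`,
    -- where it is the integral over the whole region `x > T * (c + y)`, `y > 0`.
    set Z : ℕ → ℕ → ℝ := fun s k => if k = 0 then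
      Real.exp (-(T * c)) * (n ! / (T + 1) ^ (n + 1)) else
      wedge n c T s k (bPt (n + 2) ρ T k) with hZ
    have hbPt (k : ℕ) (hk : 0 < k) (hkT : k * T < 1) :
        bPt (n + 2) ρ T k = k * T * c / (1 - k * T) := by
      have : 0 < 1 - k * T := by linarith
      have h3 : (1 : ℝ) / k - T = (1 - k * T) / k := by field_simp
      rw [bPt, hc, h3]
      field_simp
    have h1 : PDL (n + 2) ρ T = (n + 2 : ℕ) / n ! * ∑ s ∈ Finset.range (m + 1), w s * Z s s := by
      rw [PDL, if_neg (by linarith), hm, PLast_eq n ρ T hm1, PFirst_eq, ← sum_telescope]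
      obtain ⟨m', rfl⟩ : ∃ m', m = m' + 1 := ⟨m - 1, by omega⟩
      rw [Nat.add_sub_cancel, Finset.sum_range_succ' _ m',
        show Finset.Icc 2 (m' + 1) = Finset.Ico (0 + 2) (m' + 2) from rfl,
        ← Finset.sum_Ico_add' (fun k => PMid (n + 2) ρ T k) 0 m' 2, ← Finset.range_eq_Ico]
      have h4 : ∀ k ∈ Finset.range m', PMid (n + 2) ρ T (k + 2) = (n + 2 : ℕ) / n ! *
          ∑ s ∈ Finset.range (k + 1 + 1), w s * (Z s (k + 1) - Z s (k + 1 + 1)) := by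
        intro k _
        rw [PMid_eq n ρ T (by omega : 1 ≤ k + 1)]
        simp [hZ, hw, hc]
      rw [Finset.sum_congr rfl h4, ← Finset.mul_sum]
      simp only [hZ, hw, ← hc]
      simp
      ring
    have h2 : ∀ s ∈ Finset.range (m + 1), (n + 2 : ℕ) / n ! * (w s * Z s s) =
        ((n + 2).choose (s + 1) : ℝ) * (-1) ^ (s + 1 + 1) * jointProb (n + 2) c T (s + 1) := by
      intro s hs
      have hsT : s * T < 1 := (hlt s).1 (Finset.mem_range.1 hs)
      have hZs : Z s s = n ! / (1 + s) * ((1 - s * T) / (1 + T)) ^ (n + 1) *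
        Real.exp (-((1 + s) * T * c / (1 - s * T))) := by
        rcases Nat.eq_zero_or_pos s with rfl | hs0
        · simp [hZ, add_comm]
          ring
        · rw [hZ]
          simp only [hs0.ne', if_false]
          rw [hbPt s hs0 hsT, wedge_self n hc0 hT (by exact_mod_cast hs0) hsT]
      have h5 : ((s + 1 : ℕ) : ℝ) - 1 = s := by push_cast; ring
      have h6 : (n ! : ℝ) ≠ 0 := by positivity
      rw [hZs, jointProb, h5, if_pos hsT, ← choose_mul_div, hw]
      have h7 : n + 2 - 1 = n + 1 := rfl
      rw [h7]
      push_cast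
      rw [add_comm (s : ℝ) 1, pow_add, pow_add]
      field_simp
      ring
    rw [h1, Finset.mul_sum, Finset.sum_congr rfl h2, coverSum, sum_Icc_one_eq_sum_range]
    set f : ℕ → ℝ := fun s =>
      ((n + 2).choose (s + 1) : ℝ) * (-1) ^ (s + 1 + 1) * jointProb (n + 2) c T (s + 1)
    -- One sum stops at `⌈1 / T⌉₊`, the other at `N`. In a common range the extra terms vanish,
    -- through `jointProb` for the first and through the binomial coefficient for the second.
    trans ∑ s ∈ Finset.range (m + 1 + (n + 2)), f s
    · refine Finset.sum_subset (by intro x; simp; omega) fun s _ hs => ?_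
      have : ¬ (s * T < 1) := by rwa [← hlt, ← Finset.mem_range]
      have h5 : ((s + 1 : ℕ) : ℝ) - 1 = s := by push_cast; ring
      change _ * jointProb _ _ _ _ = 0
      rw [jointProb, h5, if_neg this, mul_zero]
    · refine (Finset.sum_subset (by intro x; simp; omega) fun s _ hs => ?_).symm
      have h8 : n + 2 < s + 1 := by
        rw [Finset.mem_range] at hs
        omega
      change ((n + 2).choose (s + 1) : ℝ) * _ * _ = 0
      rw [Nat.choose_eq_zero_of_lt h8, Nat.cast_zero, zero_mul, zero_mul]

/-! ### Joint exceedance probabilities of independent exponentials -/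

instance isProbabilityMeasure_expMeasure_one : IsProbabilityMeasure (expMeasure 1) :=
  isProbabilityMeasure_expMeasure one_pos

/-- The event that all beams in `J` have SINR larger than `T`, in terms of the gains `g`. -/
def jointEvent {ι : Type*} [Fintype ι] [DecidableEq ι] (c T : ℝ) (J : Finset ι) : Set (ι → ℝ) :=
  {g | ∀ n ∈ J, T * (c + ∑ i ∈ Finset.univ.erase n, g i) < g n}

lemma integrableOn_exp_neg_mul_Ioi_zero {a : ℝ} (ha : 0 < a) :
    IntegrableOn (fun x => Real.exp (-a * x)) (Set.Ioi 0) :=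
  integrableOn_exp_mul_Ioi (by linarith) 0

lemma expMeasure_one_apply (s : Set ℝ) (hs : MeasurableSet s) :
    expMeasure 1 s = ENNReal.ofReal
      (∫ x, s.indicator ((Set.Ioi 0).indicator fun x => Real.exp (-1 * x)) x) := by
  have h1 : Integrable ((Set.Ioi (0 : ℝ)).indicator fun x => Real.exp (-1 * x)) :=
    (integrableOn_exp_neg_mul_Ioi_zero one_pos).integrable_indicator measurableSet_Ioi
  rw [integral_indicator hs, ofReal_integral_eq_lintegral_ofReal h1.restrict]
  · rw [expMeasure, gammaMeasure, withDensity_apply _ hs]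
    refine lintegral_congr_ae (ae_restrict_of_ae ?_)
    -- The exponential density is positive at `0`, unlike the indicator of the open half-line; one
    -- point is negligible.
    filter_upwards [Measure.ae_ne volume (0 : ℝ)] with x hx
    change exponentialPDF 1 x = _
    rw [exponentialPDF_eq, Set.indicator_apply]
    congr 1
    by_cases h : 0 < x
    · simp [h, h.le]
    · have : ¬ 0 ≤ x := fun h' => h (lt_of_le_of_ne h' (Ne.symm hx))
      simp [h, this]
  · exact Filter.Eventually.of_forall fun x =>
      Set.indicator_nonneg (fun _ _ => (Real.exp_pos _).le) x

section

variable {ι : Type*} [Fintype ι]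

lemma prod_indicator_univ (s : ι → Set ℝ) (f : ℝ → ℝ) (x : ι → ℝ) :
    ∏ i, (s i).indicator f (x i) = (Set.univ.pi s).indicator (fun x => ∏ i, f (x i)) x := by
  classical
  by_cases h : x ∈ Set.univ.pi s
  · rw [Set.indicator_of_mem h]
    exact Finset.prod_congr rfl fun i _ => Set.indicator_of_mem (h i trivial) _
  · rw [Set.indicator_of_notMem h]
    simp only [Set.mem_univ_pi, not_forall] at h
    obtain ⟨i, hi⟩ := h
    exact Finset.prod_eq_zero (Finset.mem_univ i) (Set.indicator_of_notMem hi _)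

lemma pi_expMeasure_eq_withDensity :
    Measure.pi (fun _ : ι => expMeasure 1) = (volume : Measure (ι → ℝ)).withDensity
      (fun x => ENNReal.ofReal (∏ i, (Set.Ioi 0).indicator (fun x => Real.exp (-1 * x)) (x i))) := by
  set e : ℝ → ℝ := (Set.Ioi 0).indicator fun x => Real.exp (-1 * x) with he
  have h0 (x : ℝ) : 0 ≤ e x := Set.indicator_nonneg (fun _ _ => (Real.exp_pos _).le) x
  have h1 : Integrable e :=
    (integrableOn_exp_neg_mul_Ioi_zero one_pos).integrable_indicator measurableSet_Ioi
  have h2 : Integrable fun x : ι → ℝ => ∏ i, e (x i) := Integrable.fintype_prod fun _ => h1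
  refine Measure.pi_eq fun s hs => ?_
  rw [withDensity_apply _ (MeasurableSet.univ_pi hs),
    ← ofReal_integral_eq_lintegral_ofReal h2.restrict
      (Filter.Eventually.of_forall fun x => Finset.prod_nonneg fun i _ => h0 _),
    ← integral_indicator (MeasurableSet.univ_pi hs)]
  simp_rw [← prod_indicator_univ]
  rw [integral_fintype_prod_volume_eq_prod (fun i x => (s i).indicator e x),
    ENNReal.ofReal_prod_of_nonneg fun i _ => integral_nonneg fun x =>
      Set.indicator_nonneg (fun x _ => h0 x) x]
  exact Finset.prod_congr rfl fun i _ => (expMeasure_one_apply _ (hs i)).symm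

/-- Passing to Lebesgue measure on the open orthant prepares the change of variables below. -/
lemma pi_expMeasure_real {s : Set (ι → ℝ)} (hs : MeasurableSet s) :
    (Measure.pi (fun _ : ι => expMeasure 1)).real s =
      ∫ x in s ∩ Set.univ.pi (fun _ => Set.Ioi 0), Real.exp (-1 * ∑ i, x i) := by
  set e : ℝ → ℝ := (Set.Ioi 0).indicator fun x => Real.exp (-1 * x) with he
  have h0 (x : ℝ) : 0 ≤ e x := Set.indicator_nonneg (fun _ _ => (Real.exp_pos _).le) x
  have h1 : Integrable e :=
    (integrableOn_exp_neg_mul_Ioi_zero one_pos).integrable_indicator measurableSet_Ioi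
  have h2 : Integrable fun x : ι → ℝ => ∏ i, e (x i) := Integrable.fintype_prod fun _ => h1
  rw [measureReal_def, pi_expMeasure_eq_withDensity, withDensity_apply _ hs,
    ← ofReal_integral_eq_lintegral_ofReal h2.restrict
      (Filter.Eventually.of_forall fun x => Finset.prod_nonneg fun i _ => h0 _),
    ENNReal.toReal_ofReal (integral_nonneg fun x => Finset.prod_nonneg fun i _ => h0 _)]
  have h3 (x : ι → ℝ) : ∏ i, e (x i) = (Set.univ.pi fun _ => Set.Ioi (0 : ℝ)).indicator
      (fun x => Real.exp (-1 * ∑ i, x i)) x := by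
    simp_rw [Finset.mul_sum, Real.exp_sum]
    exact prod_indicator_univ (fun _ : ι => Set.Ioi (0 : ℝ)) (fun x => Real.exp (-1 * x)) x
  simp_rw [h3]
  rw [setIntegral_indicator (MeasurableSet.univ_pi fun _ => measurableSet_Ioi)]

lemma integral_orthant_exp {a : ℝ} (ha : 0 < a) :
    ∫ x in Set.univ.pi (fun _ : ι => Set.Ioi (0 : ℝ)), Real.exp (-a * ∑ i, x i) =
      (1 / a) ^ Fintype.card ι := by
  have h (x : ι → ℝ) : Real.exp (-a * ∑ i, x i) = ∏ i, Real.exp (-a * x i) := by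
    rw [← Real.exp_sum, ← Finset.mul_sum]
  simp_rw [h]
  rw [← integral_indicator (MeasurableSet.univ_pi fun _ => measurableSet_Ioi)]
  simp_rw [← prod_indicator_univ (fun _ : ι => Set.Ioi (0 : ℝ)) (fun x => Real.exp (-a * x))]
  rw [integral_fintype_prod_volume_eq_pow, integral_indicator measurableSet_Ioi,
    integral_exp_mul_Ioi (by linarith)]
  simp

variable [DecidableEq ι]

/-- The linear map `x ↦ x + t (∑ i, x i) 1_J`. -/
noncomputable def shear (J : Finset ι) (t : ℝ) : (ι → ℝ) →L[ℝ] (ι → ℝ) :=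
  (Matrix.toLin' (1 + Matrix.replicateCol Unit (fun i => if i ∈ J then (1 : ℝ) else 0) *
    Matrix.replicateRow Unit (fun _ : ι => t))).toContinuousLinearMap

lemma shear_apply (J : Finset ι) (t : ℝ) (x : ι → ℝ) (i : ι) :
    shear J t x i = x i + if i ∈ J then t * ∑ k, x k else 0 := by
  simp only [shear, LinearMap.coe_toContinuousLinearMap', Matrix.toLin'_apply, Matrix.add_mulVec,
    Matrix.one_mulVec, Pi.add_apply, ← Matrix.mulVec_mulVec]
  congr 1
  simp [Matrix.mulVec, dotProduct, Finset.mul_sum]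

/-- The shear is a rank-one perturbation of the identity, so the matrix determinant lemma applies.
-/
lemma det_shear (J : Finset ι) (t : ℝ) : (shear J t).det = 1 + J.card * t := by
  rw [shear, LinearMap.det_toContinuousLinearMap, LinearMap.det_toLin',
    Matrix.det_one_add_replicateCol_mul_replicateRow]
  simp [dotProduct]

lemma measurableSet_jointEvent (c T : ℝ) (J : Finset ι) : MeasurableSet (jointEvent c T J) := by
  have : jointEvent c T J =
      ⋂ n ∈ J, {g : ι → ℝ | T * (c + ∑ i ∈ Finset.univ.erase n, g i) < g n} := by
    ext g; simp [jointEvent]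
  rw [this]
  exact J.measurableSet_biInter fun n _ => measurableSet_lt (by fun_prop) (by fun_prop)

/-- Adding `T * g n` to both sides makes the threshold the same for every `n ∈ J`. -/
lemma mem_jointEvent {c T : ℝ} {J : Finset ι} {g : ι → ℝ} :
    g ∈ jointEvent c T J ↔ ∀ n ∈ J, T * (c + ∑ i, g i) < (1 + T) * g n := by
  refine forall₂_congr fun n _ => ?_
  rw [← Finset.add_sum_erase _ g (Finset.mem_univ n)]
  constructor <;> intro h <;> linarith

/-- Subtracting the common threshold `τ = T * (c + ∑ g) / (1 + T)` from the coordinates in `J` sends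
the event into the orthant. Since `∑ x = ∑ g - j * τ` with `j = J.card`, solving for `τ` gives `τ =
(T * ∑ x + T * c) / d` with `d = 1 - (j - 1) * T`, which is the shear and translation used. -/
lemma jointEvent_inter_orthant {c T : ℝ} (hc : 0 < c) (hT : 0 < T) {J : Finset ι}
    (hJ : ((J.card : ℝ) - 1) * T < 1) :
    jointEvent c T J ∩ Set.univ.pi (fun _ => Set.Ioi 0) =
      (fun x => shear J (T / (1 - (J.card - 1) * T)) x +
        fun i => if i ∈ J then T * c / (1 - (J.card - 1) * T) else 0) ''
        Set.univ.pi (fun _ => Set.Ioi 0) := by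
  set d : ℝ := 1 - (J.card - 1) * T with hd
  have hd0 : 0 < d := by linarith
  have hT1 : 0 < 1 + T := by linarith
  ext g
  constructor
  · rintro ⟨hg, hpos⟩
    rw [mem_jointEvent] at hg
    set τ := T * (c + ∑ i, g i) / (1 + T) with hτ
    have hsum : ∑ i, (g i - if i ∈ J then τ else 0) = ∑ i, g i - J.card * τ := by
      rw [Finset.sum_sub_distrib]
      simp
    have hτ2 : T / d * (∑ i, g i - J.card * τ) + T * c / d = τ := by
      have : (1 + T) * τ = T * (c + ∑ i, g i) := by rw [hτ]; field_simp
      rw [div_mul_eq_mul_div, ← add_div, div_eq_iff hd0.ne', hd]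
      linarith
    refine ⟨fun i => g i - if i ∈ J then τ else 0, fun i _ => ?_, ?_⟩
    · have hi : 0 < g i := hpos i trivial
      simp only [Set.mem_Ioi]
      split_ifs with h
      · have := hg i h
        rw [sub_pos, hτ, div_lt_iff₀ hT1]
        linarith
      · simpa using hi
    · funext i
      simp only [Pi.add_apply, shear_apply, hsum]
      split_ifs with h
      · linarith
      · simp
  · rintro ⟨x, hx, rfl⟩
    have hxp (i : ι) : 0 < x i := hx i trivial
    have hS : 0 ≤ ∑ i, x i := Finset.sum_nonneg fun i _ => (hxp i).le
    have hτ0 : 0 < T / d * ∑ i, x i + T * c / d := by positivity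
    have happ (i : ι) : (shear J (T / d) x + fun i => if i ∈ J then T * c / d else 0) i =
        x i + if i ∈ J then T / d * ∑ i, x i + T * c / d else 0 := by
      rw [Pi.add_apply, shear_apply]
      split_ifs <;> ring
    refine ⟨?_, fun i _ => ?_⟩
    · rw [mem_jointEvent]
      intro n hn
      simp only [happ, if_pos hn, Finset.sum_add_distrib]
      have : ∑ i, (if i ∈ J then T / d * ∑ i, x i + T * c / d else 0) =
          J.card * (T / d * ∑ i, x i + T * c / d) := by simp [mul_add]
      rw [this]
      set τ := T / d * ∑ i, x i + T * c / d with hτ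
      have hτd : τ * d = T * (c + ∑ i, x i) := by rw [hτ]; field_simp; ring
      rw [hd] at hτd
      have : 0 < (1 + T) * x n := mul_pos hT1 (hxp n)
      linarith
    · simp only [Set.mem_Ioi, happ]
      have := hxp i
      split_ifs <;> linarith

lemma pi_expMeasure_jointEvent {c T : ℝ} (hc : 0 < c) (hT : 0 < T) {J : Finset ι}
    (hJ : J.Nonempty) :
    (Measure.pi (fun _ : ι => expMeasure 1)).real (jointEvent c T J) =
      jointProb (Fintype.card ι) c T J.card := by
  have hcard : 0 < Fintype.card ι := Fintype.card_pos_iff.2 ⟨hJ.choose⟩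
  have hJ0 : (0 : ℝ) < J.card := by exact_mod_cast hJ.card_pos
  rw [pi_expMeasure_real (measurableSet_jointEvent c T J), jointProb]
  split_ifs with hlt
  · rw [jointEvent_inter_orthant hc hT hlt]
    set d : ℝ := 1 - (J.card - 1) * T with hd
    have hd0 : 0 < d := by linarith
    have hdet : (shear J (T / d)).det = (1 + T) / d := by
      rw [det_shear]; field_simp; linarith
    have ha : 0 < (1 + T) / d := by positivity
    have hsum (x : ι → ℝ) : ∑ i, (shear J (T / d) x +
        fun i => if i ∈ J then T * c / d else 0) i =
        (1 + T) / d * ∑ i, x i + J.card * T * c / d := by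
      have hJd : J.card * T = 1 + T - d := by linarith
      simp only [Pi.add_apply, shear_apply, Finset.sum_add_distrib]
      simp only [Finset.sum_ite_mem, Finset.univ_inter, Finset.sum_const, nsmul_eq_mul]
      calc _ = ∑ i, x i + (J.card * T) / d * ∑ i, x i + J.card * T * c / d := by ring
        _ = _ := by rw [hJd]; field_simp; ring
    rw [integral_image_eq_integral_abs_det_fderiv_smul volume
      (MeasurableSet.univ_pi fun _ => measurableSet_Ioi)
      (fun x _ => ((shear J (T / d)).hasFDerivAt.add_const _).hasFDerivWithinAt)]
    · simp only [hsum, hdet, abs_of_pos ha, smul_eq_mul]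
      have (x : ι → ℝ) : (1 + T) / d * Real.exp (-1 * ((1 + T) / d * ∑ i, x i + J.card * T * c / d))
          = ((1 + T) / d * Real.exp (-(J.card * T * c / d))) *
            Real.exp (-((1 + T) / d) * ∑ i, x i) := by
        rw [mul_assoc ((1 + T) / d), ← Real.exp_add]
        congr 2
        ring
      simp_rw [this]
      rw [integral_const_mul, integral_orthant_exp ha]
      obtain ⟨k, hk⟩ : ∃ k, Fintype.card ι = k + 1 := ⟨Fintype.card ι - 1, by omega⟩
      rw [hk, Nat.add_sub_cancel, one_div_div, pow_succ]
      field_simp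
    · intro x _ y _ hxy
      have hs : ∑ i, x i = ∑ i, y i := by
        have h := congrArg (fun z : ι → ℝ => ∑ i, z i) hxy
        simp only [hsum] at h
        have h' : (1 + T) / d * ∑ i, x i = (1 + T) / d * ∑ i, y i := by linarith
        exact mul_left_cancel₀ ha.ne' h'
      funext i
      have h := congrFun hxy i
      simp only [Pi.add_apply, shear_apply, hs] at h
      linarith
  -- Summing the conditions over `J` bounds `j * T * (c + ∑ g)` strictly by `(1 + T)` times the sum
  -- over `J`, impossible when `j * T ≥ 1 + T`.
  · have : jointEvent c T J ∩ Set.univ.pi (fun _ => Set.Ioi 0) = ∅ := by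
      rw [Set.eq_empty_iff_forall_notMem]
      rintro g ⟨hg, hpos⟩
      rw [mem_jointEvent] at hg
      have h1 : ∑ n ∈ J, T * (c + ∑ i, g i) < ∑ n ∈ J, (1 + T) * g n :=
        Finset.sum_lt_sum_of_nonempty hJ hg
      rw [Finset.sum_const, nsmul_eq_mul, ← Finset.mul_sum] at h1
      have h2 : ∑ n ∈ J, g n ≤ ∑ n, g n :=
        Finset.sum_le_sum_of_subset_of_nonneg (Finset.subset_univ J)
          fun i _ _ => (hpos i trivial).le
      have h3 : 0 ≤ ∑ n ∈ J, g n := Finset.sum_nonneg fun i _ => (hpos i trivial).le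
      have h4 : 0 < J.card * (T * c) := by positivity
      have h5 : J.card * T * ∑ n ∈ J, g n ≤ J.card * T * ∑ n, g n :=
        mul_le_mul_of_nonneg_left h2 (by positivity)
      nlinarith
    rw [this]
    simp

/-- The probability that some beam has SINR larger than `T`. -/
lemma pi_expMeasure_exists {c T : ℝ} (hc : 0 < c) (hT : 0 < T) :
    (Measure.pi (fun _ : ι => expMeasure 1)).real
      {g | ∃ n, T * (c + ∑ i ∈ Finset.univ.erase n, g i) < g n} =
      coverSum (Fintype.card ι) c T := by
  have h1 : {g : ι → ℝ | ∃ n, T * (c + ∑ i ∈ Finset.univ.erase n, g i) < g n} =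
      ⋃ n ∈ (Finset.univ : Finset ι), jointEvent c T {n} := by
    ext g; simp [jointEvent]
  have h2 (u : Finset ι) : ⋂ i ∈ u, jointEvent c T {i} = jointEvent c T u := by
    ext g; simp [jointEvent]
  rw [h1, measureReal_biUnion_eq_sum_powerset fun i _ => measurableSet_jointEvent c T {i}]
  simp_rw [h2]
  -- The value `0` at `k = 0` lets the sum run over all subsets, so that they can be grouped by
  -- cardinality.
  set f : ℕ → ℝ := fun k => if k = 0 then 0 else
    (-1) ^ (k + 1) * jointProb (Fintype.card ι) c T k with hf
  trans ∑ u ∈ (Finset.univ : Finset ι).powerset, f u.card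
  · rw [Finset.sum_filter]
    refine Finset.sum_congr rfl fun u _ => ?_
    split_ifs with hu
    · simp only [hf, hu.card_pos.ne', if_false]
      rw [pi_expMeasure_jointEvent hc hT hu]
    · rw [Finset.not_nonempty_iff_eq_empty] at hu
      simp [hf, hu]
  · rw [Finset.sum_powerset_apply_card, Finset.sum_range_succ', coverSum,
      sum_Icc_one_eq_sum_range]
    simp [hf, mul_assoc]

end

/-! ### Gaussian channels and the gains of orthonormal beams -/

instance isProbabilityMeasure_circularGaussian (v : ℝ≥0) :
    IsProbabilityMeasure (circularGaussian v) :=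
  Measure.isProbabilityMeasure_map Complex.measurableEquivRealProd.symm.measurable.aemeasurable

lemma charFun_circularGaussian_one (t : ℂ) :
    charFun (circularGaussian 1) t = Complex.exp (-(‖t‖ ^ 2 / 4 : ℝ)) := by
  rw [charFun_apply, circularGaussian, integral_map_equiv]
  have h (x : ℝ × ℝ) : Complex.exp
      (inner ℝ (Complex.measurableEquivRealProd.symm x) t * Complex.I) =
      Complex.exp (t.re * x.1 * Complex.I) * Complex.exp (t.im * x.2 * Complex.I) := by
    rw [← Complex.exp_add, Complex.inner]
    congr 1
    simp [Complex.measurableEquivRealProd_symm_apply]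
    ring
  simp_rw [h]
  rw [integral_prod_mul (fun x : ℝ => Complex.exp (t.re * x * Complex.I))
    (fun x : ℝ => Complex.exp (t.im * x * Complex.I)), ← charFun_apply_real,
    ← charFun_apply_real, charFun_gaussianReal, charFun_gaussianReal, ← Complex.exp_add]
  congr 1
  rw [← Complex.normSq_eq_norm_sq, Complex.normSq_apply]
  push_cast
  ring

/-- Polar coordinates followed by `u = r ^ 2`. -/
lemma lintegral_circularGaussian_one {f : ℝ → ENNReal} (hf : Measurable f) :
    ∫⁻ z, f (‖z‖ ^ 2) ∂circularGaussian 1 = ∫⁻ u, f u ∂expMeasure 1 := by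
  have hv : (1 / 2 : ℝ≥0) ≠ 0 := by positivity
  have hpdf (x : ℝ × ℝ) : gaussianPDF 0 (1 / 2) x.1 * gaussianPDF 0 (1 / 2) x.2 =
      ENNReal.ofReal (Real.pi⁻¹ * Real.exp (-(x.1 ^ 2 + x.2 ^ 2))) := by
    rw [gaussianPDF, gaussianPDF, ← ENNReal.ofReal_mul (gaussianPDFReal_nonneg _ _ _)]
    congr 1
    simp only [gaussianPDFReal]
    have h2 : 2 * Real.pi * ((1 / 2 : ℝ≥0) : ℝ) = Real.pi := by push_cast; ring
    rw [h2, mul_mul_mul_comm, ← mul_inv, Real.mul_self_sqrt Real.pi_pos.le, ← Real.exp_add]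
    congr 2
    push_cast
    ring
  have hm : Measurable fun x : ℝ × ℝ =>
      ENNReal.ofReal (Real.pi⁻¹ * Real.exp (-(x.1 ^ 2 + x.2 ^ 2))) := by fun_prop
  have hm2 : Measurable fun x : ℝ × ℝ => f (x.1 ^ 2 + x.2 ^ 2) := hf.comp (by fun_prop)
  have hnorm (x : ℝ × ℝ) :
      ‖Complex.measurableEquivRealProd.symm x‖ ^ 2 = x.1 ^ 2 + x.2 ^ 2 := by
    rw [← Complex.normSq_eq_norm_sq, Complex.normSq_apply,
      Complex.measurableEquivRealProd_symm_apply]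
    ring
  rw [circularGaussian, lintegral_map_equiv]
  simp_rw [hnorm]
  rw [gaussianReal_of_var_ne_zero _ hv,
    prod_withDensity (measurable_gaussianPDF _ _) (measurable_gaussianPDF _ _)]
  simp_rw [hpdf]
  rw [lintegral_withDensity_eq_lintegral_mul _ hm hm2, ← Measure.volume_eq_prod,
    ← lintegral_comp_polarCoord_symm]
  have hpol (p : ℝ × ℝ) : ENNReal.ofReal p.1 • ((fun x : ℝ × ℝ =>
      ENNReal.ofReal (Real.pi⁻¹ * Real.exp (-(x.1 ^ 2 + x.2 ^ 2)))) *
        fun x : ℝ × ℝ => f (x.1 ^ 2 + x.2 ^ 2)) (polarCoord.symm p) =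
      (ENNReal.ofReal p.1 * (ENNReal.ofReal (Real.pi⁻¹ * Real.exp (-(p.1 ^ 2))) *
        f (p.1 ^ 2))) * 1 := by
    have : (p.1 * Real.cos p.2) ^ 2 + (p.1 * Real.sin p.2) ^ 2 = p.1 ^ 2 := by
      rw [mul_pow, mul_pow, ← mul_add, Real.cos_sq_add_sin_sq, mul_one]
    simp only [Pi.mul_apply, polarCoord_symm_apply, this, smul_eq_mul, mul_one]
  have hm3 : Measurable fun r : ℝ => ENNReal.ofReal r *
      (ENNReal.ofReal (Real.pi⁻¹ * Real.exp (-(r ^ 2))) * f (r ^ 2)) := by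
    have : Measurable fun r : ℝ => f (r ^ 2) := hf.comp (by fun_prop)
    fun_prop
  simp_rw [hpol]
  rw [polarCoord_target, Measure.volume_eq_prod, ← Measure.prod_restrict,
    lintegral_prod_mul hm3.aemeasurable aemeasurable_const]
  have himg : (fun r : ℝ => r ^ 2) '' Set.Ioi 0 = Set.Ioi 0 := by
    ext u
    constructor
    · rintro ⟨r, hr, rfl⟩
      have : (0 : ℝ) < r := hr
      exact pow_pos this 2
    · intro hu
      exact ⟨√u, Real.sqrt_pos.2 hu, Real.sq_sqrt (le_of_lt hu)⟩
  have hexp : ∫⁻ u, f u ∂expMeasure 1 =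
      ∫⁻ u in Set.Ioi 0, ENNReal.ofReal (Real.exp (-u)) * f u := by
    have hm4 : Measurable (gammaPDF 1 1) := (measurable_gammaPDFReal 1 1).ennreal_ofReal
    rw [expMeasure, gammaMeasure, lintegral_withDensity_eq_lintegral_mul _ hm4 hf,
      ← lintegral_indicator measurableSet_Ioi]
    refine lintegral_congr_ae ?_
    filter_upwards [Measure.ae_ne volume (0 : ℝ)] with x hx
    change exponentialPDF 1 x * f x = _
    rw [exponentialPDF_eq]
    by_cases h : 0 < x
    · simp [h, h.le]
    · have : ¬ 0 ≤ x := fun h' => h (lt_of_le_of_ne h' (Ne.symm hx))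
      simp [h, this]
  rw [hexp]
  nth_rewrite 2 [← himg]
  rw [lintegral_image_eq_lintegral_abs_deriv_mul measurableSet_Ioi
    (f' := fun r => 2 * r) (fun r _ => by simpa using (hasDerivAt_pow 2 r).hasDerivWithinAt)
    (fun x hx y hy h => by
      have hx' : (0 : ℝ) < x := hx
      have hy' : (0 : ℝ) < y := hy
      exact (sq_eq_sq₀ hx'.le hy'.le).1 h)]
  -- The angular length `2 * π` times the normalization `π⁻¹` leaves `2 * r`, the Jacobian of `u = r
  -- ^ 2`.
  rw [setLIntegral_one, Real.volume_Ioo, ← lintegral_mul_const _ hm3]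
  refine setLIntegral_congr_fun measurableSet_Ioi fun r (hr : 0 < r) => ?_
  rw [← mul_assoc, ← mul_assoc, mul_right_comm, ← ENNReal.ofReal_mul hr.le,
    ← ENNReal.ofReal_mul (by positivity), ← ENNReal.ofReal_mul (by positivity)]
  congr 2
  have := Real.pi_ne_zero
  rw [abs_of_pos (by positivity)]
  field_simp
  ring

lemma map_norm_sq_circularGaussian_one :
    (circularGaussian 1).map (fun z => ‖z‖ ^ 2) = expMeasure 1 := by
  refine Measure.ext_of_lintegral _ fun f hf => ?_
  rw [lintegral_map hf (by fun_prop), lintegral_circularGaussian_one hf]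

section

variable {ι κ : Type*} [Fintype ι] [Fintype κ]

/-- The characteristic function of the Gaussian vector depends only on the Euclidean norm of the
frequency, which an orthonormal family preserves. -/
lemma map_orthonormal_pi_circularGaussian {q : κ → EuclideanSpace ℂ ι} (hq : Orthonormal ℂ q) :
    (Measure.pi fun _ : ι => circularGaussian 1).map (fun h k => ∑ j, h j * q k j) =
      Measure.pi fun _ : κ => circularGaussian 1 := by
  have hmeas : Measurable fun (h : ι → ℂ) (k : κ) => ∑ j, h j * q k j := by fun_prop
  have : IsProbabilityMeasure ((Measure.pi fun _ : ι => circularGaussian 1).map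
      (fun h k => ∑ j, h j * q k j)) := Measure.isProbabilityMeasure_map hmeas.aemeasurable
  rw [← charFun_eq_pi_iff]
  intro t
  -- The form `∑ h j * q k j` is bilinear, so moving the frequency `t` across it conjugates: `t`
  -- pulls back to the conjugate of `∑ conj (t k) • q k`.
  set s : EuclideanSpace ℂ ι := ∑ k, (starRingEnd ℂ) (t k) • q k with hs
  set s' : PiLp 2 (fun _ : ι => ℂ) := WithLp.toLp 2 fun j => (starRingEnd ℂ) (s j) with hs'
  have h1 : charFun (((Measure.pi fun _ : ι => circularGaussian 1).map
      (fun h k => ∑ j, h j * q k j)).map (WithLp.toLp 2)) t =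
      charFun ((Measure.pi fun _ : ι => circularGaussian 1).map (WithLp.toLp 2)) s' := by
    rw [Measure.map_map (by fun_prop) hmeas, charFun_apply, charFun_apply,
      integral_map ((WithLp.measurable_toLp 2 _).comp hmeas).aemeasurable (by fun_prop),
      integral_map (by fun_prop) (by fun_prop)]
    congr 1 with h
    congr 3
    simp only [Function.comp_apply, PiLp.inner_apply, Complex.inner, hs', hs]
    rw [← Complex.re_sum, ← Complex.re_sum]
    congr 1
    simp only [map_sum, map_mul, Finset.sum_mul, WithLp.ofLp_sum, Finset.sum_apply,
      WithLp.ofLp_smul, Pi.smul_apply, smul_eq_mul, Complex.conj_conj, Finset.mul_sum]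
    rw [Finset.sum_comm]
    exact Finset.sum_congr rfl fun _ _ => Finset.sum_congr rfl fun _ _ => by ring
  have h2 : ∑ j, ‖s j‖ ^ 2 = ∑ k, ‖t k‖ ^ 2 := by
    rw [← EuclideanSpace.norm_sq_eq, ← Complex.ofReal_inj]
    have h := hq.inner_sum (fun k => (starRingEnd ℂ) (t k)) (fun k => (starRingEnd ℂ) (t k))
      Finset.univ
    rw [← hs, inner_self_eq_norm_sq_to_K] at h
    push_cast
    refine h.trans (Finset.sum_congr rfl fun k _ => ?_)
    rw [Complex.conj_conj, Complex.mul_conj, Complex.normSq_eq_norm_sq]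
    push_cast
    rfl
  rw [h1, charFun_pi]
  simp_rw [charFun_circularGaussian_one]
  rw [← Complex.exp_sum, ← Complex.exp_sum, Finset.sum_neg_distrib, Finset.sum_neg_distrib,
    ← Complex.ofReal_sum, ← Complex.ofReal_sum, ← Finset.sum_div, ← Finset.sum_div, ← h2]
  simp [hs']

/-- The gains of orthonormal beams over a Rayleigh channel are independent standard
exponentials. -/
lemma map_gain_pi_circularGaussian {q : κ → EuclideanSpace ℂ ι} (hq : Orthonormal ℂ q) :
    (Measure.pi fun _ : ι => circularGaussian 1).map (fun h k => ‖∑ j, h j * q k j‖ ^ 2) =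
      Measure.pi fun _ : κ => expMeasure 1 := by
  have h := Measure.pi_map_pi (μ := fun _ : κ => circularGaussian 1)
    (f := fun _ z => ‖z‖ ^ 2) (fun _ => by fun_prop)
  simp_rw [map_norm_sq_circularGaussian_one] at h
  rw [← h, ← map_orthonormal_pi_circularGaussian hq, Measure.map_map (by fun_prop) (by fun_prop)]
  rfl

end

/-! ### Coverage probabilities -/

lemma beamGain_nonneg {Nt : ℕ} (h : Fin Nt → ℂ) (p : EuclideanSpace ℂ (Fin Nt)) :
    0 ≤ beamGain h p := sq_nonneg _

lemma lt_sinr_iff {N Nt : ℕ} (hN : 1 ≤ N) {PT σ2 : ℝ} (hPT : 0 < PT) (hσ2 : 0 < σ2) (T : ℝ)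
    (h : Fin Nt → ℂ) (p : Fin N → EuclideanSpace ℂ (Fin Nt)) (n : Fin N) :
    T < sinr PT σ2 h p n ↔
      T * (N / (PT / σ2) + ∑ i ∈ Finset.univ.erase n, beamGain h (p i)) < beamGain h (p n) := by
  have hN0 : (0 : ℝ) < N := by exact_mod_cast hN
  have hS : 0 ≤ ∑ i ∈ Finset.univ.erase n, beamGain h (p i) :=
    Finset.sum_nonneg fun i _ => beamGain_nonneg _ _
  rw [sinr, ← Finset.sum_mul, lt_div_iff₀ (by positivity)]
  have hk : 0 < PT / N := by positivity
  have : T * (σ2 + (∑ i ∈ Finset.univ.erase n, beamGain h (p i)) * (PT / N)) =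
      T * (N / (PT / σ2) + ∑ i ∈ Finset.univ.erase n, beamGain h (p i)) * (PT / N) := by
    field_simp
  rw [this, mul_lt_mul_iff_left₀ hk]

/-- Copies of an orthonormal family of beams, one for each receive antenna. -/
lemma orthonormal_antennas {N D Nr Nt : ℕ} {p : Fin N → Fin D → EuclideanSpace ℂ (Fin Nt)}
    (hp : Orthonormal ℂ fun x : Fin N × Fin D => p x.1 x.2) :
    Orthonormal ℂ fun x : (Fin Nr × Fin D) × Fin N =>
      (WithLp.toLp 2 fun y : Fin Nr × Fin Nt => if y.1 = x.1.1 then p x.2 x.1.2 y.2 else 0 :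
        EuclideanSpace ℂ (Fin Nr × Fin Nt)) := by
  rw [orthonormal_iff_ite] at hp ⊢
  rintro ⟨⟨r, d⟩, n⟩ ⟨⟨r', d'⟩, n'⟩
  have h := hp (n, d) (n', d')
  rw [PiLp.inner_apply, Fintype.sum_prod_type]
  rw [PiLp.inner_apply] at h
  rw [Finset.sum_eq_single r (fun b _ hb => by simp [hb]) (by simp)]
  by_cases hr : r = r'
  · subst hr
    simp only [if_true]
    rw [h]
    simp [and_comm]
  · simp [hr]

/-- Grouping the coordinates of a finite product measure. -/
lemma map_curry_pi {ι κ : Type*} [Fintype ι] [Fintype κ] (ν : Measure ℝ)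
    [IsProbabilityMeasure ν] :
    (Measure.pi fun _ : ι × κ => ν).map (fun g i k => g (i, k)) =
      Measure.pi fun _ : ι => Measure.pi fun _ : κ => ν := by
  have h := Measure.infinitePi_map_curry (ι := ι) (κ := κ) (fun _ _ => ν)
  simp only [Measure.infinitePi_eq_pi] at h
  exact h

/-- Distinct values of the first index give disjoint blocks of independent coordinates, so the
failure probabilities multiply. -/
lemma pi_expMeasure_forall {ι κ : Type*} [Fintype ι] [Fintype κ] [DecidableEq κ] {c T : ℝ}
    (hc : 0 < c) (hT : 0 < T) :
    (Measure.pi fun _ : ι × κ => expMeasure 1).real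
      {g | ∀ x n, ¬ T * (c + ∑ i ∈ Finset.univ.erase n, g (x, i)) < g (x, n)} =
      (1 - coverSum (Fintype.card κ) c T) ^ Fintype.card ι := by
  set B : Set (κ → ℝ) := {g | ∃ n, T * (c + ∑ i ∈ Finset.univ.erase n, g i) < g n} with hB
  have hBm : MeasurableSet B := by
    have : B = ⋃ n, jointEvent c T {n} := by ext g; simp [hB, jointEvent]
    rw [this]
    exact MeasurableSet.iUnion fun n => measurableSet_jointEvent c T {n}
  have h1 : {g : ι × κ → ℝ | ∀ x n, ¬ T * (c + ∑ i ∈ Finset.univ.erase n, g (x, i)) < g (x, n)} =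
      (fun g i k => g (i, k)) ⁻¹' Set.univ.pi fun _ : ι => Bᶜ := by
    ext g; simp [hB]
  rw [h1, ← map_measureReal_apply (by fun_prop) (MeasurableSet.univ_pi fun _ => hBm.compl),
    map_curry_pi, measureReal_def, Measure.pi_pi, Finset.prod_const, ENNReal.toReal_pow,
    ← measureReal_def, probReal_compl_eq_one_sub hBm, pi_expMeasure_exists hc hT]
  rfl

lemma map_rayleigh {Ω ι : Type*} [MeasurableSpace Ω] [Fintype ι] {μ : Measure Ω}
    [IsProbabilityMeasure μ] {X : ι → Ω → ℂ} (hX : IsRayleighFading X μ) :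
    μ.map (fun ω i => X i ω) = Measure.pi fun _ => circularGaussian 1 := by
  rw [(iIndepFun_iff_map_fun_eq_pi_map fun i => (hX.2 i).aemeasurable).1 hX.1]
  simp_rw [fun i => (hX.2 i).map_eq]

lemma measurableSet_orthonormal {N D Nt : ℕ} :
    MeasurableSet {p : Fin N → Fin D → EuclideanSpace ℂ (Fin Nt) |
      Orthonormal ℂ fun x : Fin N × Fin D => p x.1 x.2} := by
  simp only [orthonormal_iff_ite, Set.ofPred_forall]
  refine MeasurableSet.iInter fun x => MeasurableSet.iInter fun y => measurableSet_eq_fun ?_ ?_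
  · have h (z : Fin N × Fin D) :
        Measurable fun p : Fin N → Fin D → EuclideanSpace ℂ (Fin Nt) => p z.1 z.2 := by fun_prop
    exact (h x).inner (h y)
  · exact measurable_const

lemma measurable_beamGain {N D Nr Nt : ℕ} (r : Fin Nr) (n : Fin N) (d : Fin D) :
    Measurable fun z : (Fin Nr × Fin Nt → ℂ) × (Fin N → Fin D → EuclideanSpace ℂ (Fin Nt)) =>
      beamGain (fun j => z.1 (r, j)) (z.2 n d) := by
  have h (j : Fin Nt) : Measurable fun z : (Fin Nr × Fin Nt → ℂ) ×
      (Fin N → Fin D → EuclideanSpace ℂ (Fin Nt)) => z.2 n d j := by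
    have h1 : Measurable fun z : (Fin Nr × Fin Nt → ℂ) ×
      (Fin N → Fin D → EuclideanSpace ℂ (Fin Nt)) => z.2 n d := by fun_prop
    exact (measurable_pi_apply j).comp ((WithLp.measurable_ofLp 2 _).comp h1)
  unfold beamGain
  fun_prop

/-- The probability that no beam, slot and antenna has SINR larger than `T`. -/
lemma measureReal_no_coverage {Ω : Type*} [MeasurableSpace Ω] {μ : Measure Ω}
    [IsProbabilityMeasure μ] {N D Nr Nt : ℕ} {c T : ℝ} (hc : 0 < c) (hT : 0 < T)
    {p : Ω → Fin N → Fin D → EuclideanSpace ℂ (Fin Nt)} (hp : AEMeasurable p μ)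
    (horth : ∀ᵐ ω ∂μ, Orthonormal ℂ (fun x : Fin N × Fin D => p ω x.1 x.2))
    {H : Ω → Fin Nr → Fin Nt → ℂ}
    (hH : IsRayleighFading (fun (x : Fin Nr × Fin Nt) ω => H ω x.1 x.2) μ)
    (hind : IndepFun H p μ) :
    NullMeasurableSet {ω | ∀ (x : Fin Nr × Fin D) (n : Fin N),
        ¬ T * (c + ∑ i ∈ Finset.univ.erase n, beamGain (H ω x.1) (p ω i x.2)) <
          beamGain (H ω x.1) (p ω n x.2)} μ ∧
    μ.real {ω | ∀ (x : Fin Nr × Fin D) (n : Fin N),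
        ¬ T * (c + ∑ i ∈ Finset.univ.erase n, beamGain (H ω x.1) (p ω i x.2)) <
          beamGain (H ω x.1) (p ω n x.2)} = (1 - coverSum N c T) ^ (Nr * D) := by
  set S : Set ((Fin Nr × Fin Nt → ℂ) × (Fin N → Fin D → EuclideanSpace ℂ (Fin Nt))) :=
    {z | ∀ (x : Fin Nr × Fin D) (n : Fin N),
      ¬ T * (c + ∑ i ∈ Finset.univ.erase n, beamGain (fun j => z.1 (x.1, j)) (z.2 i x.2)) <
          beamGain (fun j => z.1 (x.1, j)) (z.2 n x.2)} with hS
  have hSm : MeasurableSet S := by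
    simp only [hS, Set.ofPred_forall]
    refine MeasurableSet.iInter fun x => MeasurableSet.iInter fun n => ?_
    refine (measurableSet_lt ?_ (measurable_beamGain _ _ _)).compl
    have := Finset.measurable_fun_sum (Finset.univ.erase n)
      fun i _ => measurable_beamGain (Nt := Nt) x.1 i x.2
    fun_prop
  set F : Ω → Fin Nr × Fin Nt → ℂ := fun ω x => H ω x.1 x.2 with hF
  have hFm : AEMeasurable F μ := aemeasurable_pi_lambda _ fun x => (hH.2 x).aemeasurable
  have hFind : IndepFun F p μ :=
    hind.comp (by fun_prop :
      Measurable fun (h : Fin Nr → Fin Nt → ℂ) (x : Fin Nr × Fin Nt) => h x.1 x.2) measurable_id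
  have hlaw : μ.map (fun ω => (F ω, p ω)) =
      (Measure.pi fun _ => circularGaussian 1).prod (μ.map p) := by
    rw [(indepFun_iff_map_prod_eq_prod_map_map hFm hp).1 hFind, map_rayleigh hH]
  have hpre : {ω | ∀ (x : Fin Nr × Fin D) (n : Fin N),
        ¬ T * (c + ∑ i ∈ Finset.univ.erase n, beamGain (H ω x.1) (p ω i x.2)) <
          beamGain (H ω x.1) (p ω n x.2)} = (fun ω => (F ω, p ω)) ⁻¹' S := rfl
  have hpair : AEMeasurable (fun ω => (F ω, p ω)) μ := hFm.prodMk hp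
  have : IsProbabilityMeasure (μ.map p) := Measure.isProbabilityMeasure_map hp
  rw [hpre]
  refine ⟨hpair.nullMeasurableSet_preimage hSm, ?_⟩
  -- For almost every fixed precoder family `q`, the failure probability is that of i.i.d.
  -- exponential gains and does not depend on `q`. Integrating over the law of `p` is then trivial.
  have hfiber : ∀ᵐ q ∂(μ.map p), (Measure.pi fun _ => circularGaussian 1)
      ((fun h => (h, q)) ⁻¹' S) = (Measure.pi fun _ : (Fin Nr × Fin D) × Fin N => expMeasure 1)
      {g | ∀ x n, ¬ T * (c + ∑ i ∈ Finset.univ.erase n, g (x, i)) < g (x, n)} := by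
    have h1 : ∀ᵐ q ∂(μ.map p), Orthonormal ℂ fun x : Fin N × Fin D => q x.1 x.2 :=
      (ae_map_iff hp measurableSet_orthonormal).2 horth
    filter_upwards [h1] with q hq
    rw [← map_gain_pi_circularGaussian (orthonormal_antennas (Nr := Nr) hq),
      Measure.map_apply (by fun_prop)]
    · congr 1
      have hg (h : Fin Nr × Fin Nt → ℂ) (r : Fin Nr) (d : Fin D) (n : Fin N) :
          ‖∑ y : Fin Nr × Fin Nt, h y * if y.1 = r then q n d y.2 else 0‖ ^ 2 =
          beamGain (fun j => h (r, j)) (q n d) := by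
        rw [Fintype.sum_prod_type, Finset.sum_eq_single r (fun b _ hb => by simp [hb]) (by simp)]
        simp [beamGain]
      ext h
      simp only [hS, Set.mem_preimage, Set.mem_ofPred_eq, hg]
    · simp only [Set.ofPred_forall]
      refine MeasurableSet.iInter fun x => MeasurableSet.iInter fun n => ?_
      have h2 : MeasurableSet {g : (Fin Nr × Fin D) × Fin N → ℝ |
          T * (c + ∑ i ∈ Finset.univ.erase n, g (x, i)) < g (x, n)} :=
        measurableSet_lt (by fun_prop) (by fun_prop)
      exact h2.compl
  rw [measureReal_def, ← Measure.map_apply_of_aemeasurable hpair hSm, hlaw,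
    Measure.prod_apply_symm hSm, lintegral_congr_ae hfiber, lintegral_const, measure_univ, mul_one,
    ← measureReal_def, pi_expMeasure_forall hc hT]
  simp

theorem coverageASMPG_eq {Ω : Type*} [MeasurableSpace Ω] {μ : Measure Ω}
    [IsProbabilityMeasure μ] {N D Nr Nt : ℕ} (hN : 1 ≤ N) (hD : 1 ≤ D) (hNr : 1 ≤ Nr)
    {PT σ2 T : ℝ} (hPT : 0 < PT) (hσ2 : 0 < σ2) (hT : 0 < T) (hTN : 1 ≤ T ∨ 2 ≤ N)
    {p : Ω → Fin N → Fin D → EuclideanSpace ℂ (Fin Nt)} (hp : AEMeasurable p μ)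
    (horth : ∀ᵐ ω ∂μ, Orthonormal ℂ (fun x : Fin N × Fin D => p ω x.1 x.2))
    {H : Ω → Fin Nr → Fin Nt → ℂ}
    (hH : IsRayleighFading (fun (x : Fin Nr × Fin Nt) ω => H ω x.1 x.2) μ)
    (hind : IndepFun H p μ) :
    coverageASMPG μ PT σ2 T H p = 1 - (1 - PDL N (PT / σ2) T) ^ (Nr * D) := by
  have : NeZero N := ⟨by omega⟩
  have : NeZero D := ⟨by omega⟩
  have : NeZero Nr := ⟨by omega⟩
  have hN0 : (0 : ℝ) < N := by exact_mod_cast hN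
  obtain ⟨hnull, hval⟩ := measureReal_no_coverage (c := N / (PT / σ2)) (by positivity) hT hp
    horth hH hind
  have hset : {ω | T < ⨆ x : Fin N × Fin D × Fin Nr,
      sinr PT σ2 (H ω x.2.2) (fun i => p ω i x.2.1) x.1} =
      {ω | ∀ (x : Fin Nr × Fin D) (n : Fin N),
        ¬ T * (N / (PT / σ2) + ∑ i ∈ Finset.univ.erase n, beamGain (H ω x.1) (p ω i x.2)) <
          beamGain (H ω x.1) (p ω n x.2)}ᶜ := by
    ext ω
    simp only [Set.mem_ofPred_eq, Set.mem_compl_iff]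
    -- A supremum of finitely many values exceeds `T` exactly when one of them does; finiteness
    -- supplies the bound that a real supremum requires.
    rw [lt_ciSup_iff (Set.finite_range _).bddAbove]
    simp only [lt_sinr_iff hN hPT hσ2]
    push Not
    constructor
    · rintro ⟨⟨n, d, r⟩, h⟩
      exact ⟨(r, d), n, h⟩
    · rintro ⟨⟨r, d⟩, n, h⟩
      exact ⟨(n, d, r), h⟩
  rw [coverageASMPG, hset, probReal_compl_eq_one_sub₀ hnull, hval,
    PDL_eq_coverSum hN (by positivity) hT hTN]

/-- Reduces the single-antenna claim to antenna selection with one antenna. -/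
lemma coverageMPG_eq_coverageASMPG {Ω : Type*} [MeasurableSpace Ω] (μ : Measure Ω) {N D Nt : ℕ}
    (PT σ2 T : ℝ) (h : Ω → Fin Nt → ℂ)
    (p : Ω → Fin N → Fin D → EuclideanSpace ℂ (Fin Nt)) :
    coverageMPG μ PT σ2 T h p = coverageASMPG μ PT σ2 T (fun ω (_ : Fin 1) => h ω) p := by
  have hsup (ω : Ω) : ⨆ x : Fin N × Fin D, sinr PT σ2 (h ω) (fun i => p ω i x.2) x.1 =
      ⨆ x : Fin N × Fin D × Fin 1, sinr PT σ2 (h ω) (fun i => p ω i x.2.1) x.1 :=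
    (Equiv.iSup_congr ((Equiv.refl _).prodCongr (Equiv.prodUnique (Fin D) (Fin 1)))
      fun x => rfl).symm
  simp only [coverageMPG, coverageASMPG, hsup]

end ORP

theorem theorem3 {Ω : Type*} [MeasurableSpace Ω] (μ : Measure Ω) [IsProbabilityMeasure μ]
    (N D Nt : ℕ) (hN : 1 ≤ N) (hD : 1 ≤ D)
    (PT σ2 T : ℝ) (hPT : 0 < PT) (hσ2 : 0 < σ2) (hT : 0 < T) (hTN : 1 ≤ T ∨ 2 ≤ N)
    (p : Ω → Fin N → Fin D → EuclideanSpace ℂ (Fin Nt)) (hp : AEMeasurable p μ)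
    (horth : ∀ᵐ ω ∂μ, Orthonormal ℂ (fun x : Fin N × Fin D => p ω x.1 x.2)) :
    (∀ h : Ω → Fin Nt → ℂ,
      ORP.IsRayleighFading (fun j ω => h ω j) μ → IndepFun h p μ →
        ORP.coverageMPG μ PT σ2 T h p = 1 - (1 - ORP.PDL N (PT / σ2) T) ^ D) ∧
    (∀ (Nr : ℕ) (H : Ω → Fin Nr → Fin Nt → ℂ), 1 ≤ Nr →
      ORP.IsRayleighFading (fun (x : Fin Nr × Fin Nt) ω => H ω x.1 x.2) μ → IndepFun H p μ →
        ORP.coverageASMPG μ PT σ2 T H p = 1 - (1 - ORP.PDL N (PT / σ2) T) ^ (Nr * D)) := by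
  refine ⟨fun h hh hind => ?_, fun Nr H hNr hH hind =>
    ORP.coverageASMPG_eq hN hD hNr hPT hσ2 hT hTN hp horth hH hind⟩
  have hfade : ORP.IsRayleighFading (fun (x : Fin 1 × Fin Nt) ω => h ω x.2) μ :=
    ⟨hh.1.precomp (g := fun x : Fin 1 × Fin Nt => x.2)
      fun x y hxy => Prod.ext (Subsingleton.elim _ _) hxy, fun x => hh.2 x.2⟩
  have hind' : IndepFun (fun ω (_ : Fin 1) => h ω) p μ :=
    hind.comp (by fun_prop : Measurable fun (f : Fin Nt → ℂ) (_ : Fin 1) => f) measurable_id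
  rw [ORP.coverageMPG_eq_coverageASMPG,
    ORP.coverageASMPG_eq hN hD le_rfl hPT hσ2 hT hTN hp horth hfade hind', one_mul]
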